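/- **Setting.** Let $n,d,m,b,T_o,K\ge 1$ be integers. Agent $i\in\{1,\dots,n\}$ holds a data set $\mathcal D_i$ of $m$ samples and has the local loss $f_i(x)=\frac1m\sum_{z\in\mathcal D_i}\ell(x;z)$, $x\in\mathbb R^d$; put $f=\frac1n\sum_i f_i$ and assume $f$ is bounded below, $f^\star=\inf f$. Let $W\in\mathbb R^{n\times n}$ be a mixing matrix of an undirected graph on the agents: $W$ is entrywise nonnegative and doubly stochastic, and $w_{ij}=0$ if and only if $i\neq j$ and $\{i,j\}$ is not an edge. Let $J=\frac1n\mathbf 1\mathbf 1^\top$, $\lambda_w=1-\|W-J\|_2^2$ (spectral norm), $p\in[0,1]$, $\lambda_p=\lambda_w+p(1-\lambda_w)$, and assume $\lambda_p>0$. For a mini-batch $\mathcal Z_i$ of $b$ samples of $\mathcal D_i$ let $g_i(x;\mathcal Z_i)=\frac1b\sum_{z\in\mathcal Z_i}\nabla\ell(x;z)$, and for $X=[x_1,\dots,x_n]\in\mathbb R^{d\times n}$ and $\mathcal Z=(\mathcal Z_1,\dots,\mathcal Z_n)$ let $G(X;\mathcal Z)=[g_1(x_1;\mathcal Z_1),\dots,g_n(x_n;\mathcal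 Z_n)]$. With step sizes $\eta_c,\eta_l>0$, PISCO starts from $X^0=x^0\mathbf 1^\top$, $Y^0=G^0=G(X^0;\mathcal Z^0)$ and, in round $k=0,1,\dots$, puts $(X^{k+1,0},Y^{k+1,0},G^{k+1,0})=(X^k,Y^k,G^k)$; performs for $t=1,\dots,T_o$ $$X^{k+1,t}=X^{k+1,t-1}-\eta_lY^{k+1,t-1},\quad G^{k+1,t}=G(X^{k+1,t};\mathcal Z^{k+1,t}),\quad Y^{k+1,t}=Y^{k+1,t-1}+G^{k+1,t}-G^{k+1,t-1};$$ and then, with $W^k=J$ with probability $p$ and $W^k=W$ otherwise, $$X^{k+1}=\big((1-\eta_c)X^k+\eta_c(X^{k+1,T_o}-\eta_lY^{k+1,T_o})\big)W^k,\quad G^{k+1}=G(X^{k+1};\mathcal Z^{k+1}),\quad Y^{k+1}=(Y^{k+1,T_o}+G^{k+1}-G^{k+1,T_o})W^k.$$ All mini-batches (over all agents and draws) and all choices of $W^k$ are mutually independent. **Assumptions.** Each $f_i$ is differentiable with $\|\nabla f_i(x)-\nabla f_i(y)\|_2\le L\|x-y\|_2$ for all $x,y$, where $L>0$. For some $\sigma\ge0$,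 every drawn mini-batch $\mathcal Z_i$ of every agent $i$ satisfies, for every $x\in\mathbb R^d$, $\mathbb E[g_i(x;\mathcal Z_i)]=\nabla f_i(x)$ and $\mathbb E\|g_i(x;\mathcal Z_i)-\nabla f_i(x)\|_2^2\le\sigma^2/b$. (Nothing is assumed about the dissimilarity of the $f_i$.) **Theorem (convergence rate with mini-batch gradients).** There is an absolute constant $C>0$ such that the following holds in every such setting. Let $\alpha\ge1$, $\eta_c=\alpha\sqrt{1+p}\,\lambda_p$, $0<\eta_l\le\dfrac{\sqrt{1+p}\,\lambda_p}{360\,\alpha L(T_o+1)}$ and $\eta=\eta_c\eta_l$. Then, with $\bar x^k=\frac1n\sum_i x_i^k$, $\tilde f=f(\bar x^0)-f^\star$ and $\Phi_y^0=Y^0-Y^0J$, the expectations below are finite and $$\frac1K\sum_{k=0}^{K-1}\mathbb E\|\nabla f(\bar x^k)\|_2^2\le C\left(\frac{\tilde f}{\eta T_oK}+\Big(L^2T_o^2\eta_l^2+\frac{L\eta}{n}\Big)\frac{\sigma^2}{b}\right)+C\left(\frac{(1-p)L^2T_o^2\eta^2}{(1+p)^2\lambda_p^4}\frac{\sigma^2}{b}+\frac1{nK}\mathbb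 E\|\Phi_y^0\|_{\mathsf F}^2\right).$$ -/

import Mathlib

open MeasureTheory ProbabilityTheory

namespace PISCO

noncomputable section

/-- The space `ℝ^d` with its Euclidean norm. -/
abbrev Vec (d : ℕ) : Type := EuclideanSpace ℝ (Fin d)

/-- A matrix in `ℝ^{d × n}`, given by its `n` columns (one column per agent). -/
abbrev Cols (d n : ℕ) : Type := Fin n → Vec d

/-- A mini-batch of size `b`: the positions of its samples in a data set with `m` samples. -/
abbrev Batch (m b : ℕ) : Type := Fin b → Fin m

/-! ### Column matrices and mixing -/

/-- The squared Frobenius norm. -/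
def frobSq {d n : ℕ} (X : Cols d n) : ℝ := ∑ i, ‖X i‖ ^ 2

/-- The product `X W`: its column `j` is `∑ i, W i j • X i`. -/
def mix {d n : ℕ} (X : Cols d n) (W : Matrix (Fin n) (Fin n) ℝ) : Cols d n :=
  fun j => ∑ i, W i j • X i

/-- The average of the columns. -/
def avg {d n : ℕ} (X : Cols d n) : Vec d := (1 / (n : ℝ)) • ∑ i, X i

/-- The averaging matrix `J = (1/n) 1 1ᵀ`. -/
def avgMatrix (n : ℕ) : Matrix (Fin n) (Fin n) ℝ := Matrix.of fun _ _ => 1 / (n : ℝ)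

/-- `W` is a mixing matrix of the undirected graph `G`: it is entrywise nonnegative and doubly
stochastic, and `W i j = 0` exactly when `i ≠ j` and `i`, `j` are not connected by an edge. -/
structure IsMixingMatrix {n : ℕ} (G : SimpleGraph (Fin n)) (W : Matrix (Fin n) (Fin n) ℝ) :
    Prop where
  doubly_stochastic : W ∈ doublyStochastic ℝ (Fin n)
  eq_zero_iff : ∀ i j, W i j = 0 ↔ ¬ G.Adj i j ∧ i ≠ j

/-- The mixing rate `λ_w = 1 - ‖W - J‖₂²` (spectral norm). -/
def mixingRate {n : ℕ} (W : Matrix (Fin n) (Fin n) ℝ) : ℝ :=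
  1 - ‖Matrix.toEuclideanCLM (n := Fin n) (𝕜 := ℝ) (W - avgMatrix n)‖ ^ 2

/-- The expected mixing rate `λ_p = λ_w + p (1 - λ_w)`. -/
def expectedMixingRate {n : ℕ} (W : Matrix (Fin n) (Fin n) ℝ) (p : ℝ) : ℝ :=
  mixingRate W + p * (1 - mixingRate W)

/-! ### Objectives and stochastic gradients -/

/-- The local objective `f_i(x) = (1/m) ∑_{z ∈ D_i} ℓ(x; z)`. -/
def localLoss {d n m : ℕ} {S : Type*} (loss : Vec d → S → ℝ) (D : Fin n → Fin m → S)
    (i : Fin n) (x : Vec d) : ℝ :=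
  (1 / (m : ℝ)) * ∑ j, loss x (D i j)

/-- The global objective `f(x) = (1/n) ∑_i f_i(x)`. -/
def globalLoss {d n m : ℕ} {S : Type*} (loss : Vec d → S → ℝ) (D : Fin n → Fin m → S)
    (x : Vec d) : ℝ :=
  (1 / (n : ℝ)) * ∑ i, localLoss loss D i x

/-- The mini-batch gradient `g_i = (1/b) ∑_{z ∈ Z_i} ∇ℓ(x; z)` of agent `i` at the point `x`. -/
def stochGrad {d n m b : ℕ} {S : Type*} (loss : Vec d → S → ℝ) (D : Fin n → Fin m → S)
    (i : Fin n) (Z : Batch m b) (x : Vec d) : Vec d :=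
  (1 / (b : ℝ)) • ∑ j, gradient (fun u => loss u (D i (Z j))) x

/-- The distributed stochastic gradient `G = [g_1, …, g_n]` at `X = [x_1, …, x_n]`. -/
def stochGrads {d n m b : ℕ} {S : Type*} (loss : Vec d → S → ℝ) (D : Fin n → Fin m → S)
    (Z : Fin n → Batch m b) (X : Cols d n) : Cols d n :=
  fun i => stochGrad loss D i (Z i) (X i)

/-- `g` is differentiable with `L`-Lipschitz gradient. -/
structure IsLSmooth {d : ℕ} (g : Vec d → ℝ) (L : ℝ) : Prop where
  differentiable : Differentiable ℝ g
  lipschitz : ∀ x y, ‖gradient g x - gradient g y‖ ≤ L * ‖x - y‖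

/-! ### The algorithm -/

/-- The variables `X`, `Y`, `G` (models, gradient trackers, stochastic gradients). -/
structure State (d n : ℕ) where
  X : Cols d n
  Y : Cols d n
  G : Cols d n

/-- One local update, with the mini-batches `Z`. -/
def localStep {d n m b : ℕ} {S : Type*} (loss : Vec d → S → ℝ) (D : Fin n → Fin m → S)
    (ηl : ℝ) (Z : Fin n → Batch m b) (s : State d n) : State d n :=
  let X' : Cols d n := s.X - ηl • s.Y
  let G' : Cols d n := stochGrads loss D Z X'
  { X := X', Y := s.Y + G' - s.G, G := G' }

/-- The state after `t` local updates started at `s`; update number `t` uses the batches `Z t`. -/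
def localIter {d n m b : ℕ} {S : Type*} (loss : Vec d → S → ℝ) (D : Fin n → Fin m → S)
    (ηl : ℝ) (Z : ℕ → Fin n → Batch m b) (s : State d n) : ℕ → State d n
  | 0 => s
  | t + 1 => localStep loss D ηl (Z (t + 1)) (localIter loss D ηl Z s t)

/-- The communication update: `s` is the state at the beginning of the round, `s'` the state after
the local updates, `Wk` the mixing matrix of the round, `Z` the newly drawn mini-batches. -/
def commStep {d n m b : ℕ} {S : Type*} (loss : Vec d → S → ℝ) (D : Fin n → Fin m → S)
    (ηc ηl : ℝ) (Wk : Matrix (Fin n) (Fin n) ℝ) (Z : Fin n → Batch m b) (s s' : State d n) :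
    State d n :=
  let X' : Cols d n := mix ((1 - ηc) • s.X + ηc • (s'.X - ηl • s'.Y)) Wk
  let G' : Cols d n := stochGrads loss D Z X'
  { X := X', Y := mix (s'.Y + G' - s'.G) Wk, G := G' }

/-- The iterates `(X^k, Y^k, G^k)` of PISCO for a realization of its random choices.
`server k` says whether round `k` uses the server (mixing matrix `J`) or gossip (mixing matrix `W`).
`Z k 0` are the mini-batches at which `G^k` is computed, and, for `1 ≤ t ≤ To`, `Z k t` are the
mini-batches of the local update number `t` of round `k`. All agents start at `x0`. -/
def iterates {d n m b : ℕ} {S : Type*} (loss : Vec d → S → ℝ) (D : Fin n → Fin m → S)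
    (W : Matrix (Fin n) (Fin n) ℝ) (To : ℕ) (ηc ηl : ℝ) (x0 : Vec d)
    (server : ℕ → Bool) (Z : ℕ → ℕ → Fin n → Batch m b) : ℕ → State d n
  | 0 =>
    let G0 : Cols d n := stochGrads loss D (Z 0 0) (fun _ => x0)
    { X := fun _ => x0, Y := G0, G := G0 }
  | k + 1 =>
    let s := iterates loss D W To ηc ηl x0 server Z k
    commStep loss D ηc ηl (if server k then avgMatrix n else W) (Z (k + 1) 0) s
      (localIter loss D ηl (Z k) s To)

/-! ### The random choices -/

/-- The random choices of the algorithm: each round uses the server with probability `p`, and all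
the choices (the server choices of all rounds, and the mini-batches of all draws and all agents)
are mutually independent. -/
structure IsSampling {Ω : Type*} [MeasurableSpace Ω] {n m b : ℕ} (μ : Measure Ω) (p : ℝ)
    (server : ℕ → Ω → Bool) (batch : ℕ → ℕ → Fin n → Ω → Batch m b) : Prop where
  measurable_server : ∀ k, Measurable (server k)
  measurable_batch : ∀ k t i, Measurable (batch k t i)
  server_prob : ∀ k, μ.real {ω | server k ω = true} = p
  indep : iIndep
    (Sum.elim (fun k : ℕ => MeasurableSpace.comap (server k) inferInstance)
      (fun q : ℕ × ℕ × Fin n => MeasurableSpace.comap (batch q.1 q.2.1 q.2.2) inferInstance)) μ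

/-- Every mini-batch gradient is unbiased with variance at most `σ² / b`, at every point. -/
structure IsUnbiasedBoundedVariance {Ω : Type*} [MeasurableSpace Ω] {d n m b : ℕ} {S : Type*}
    (μ : Measure Ω) (loss : Vec d → S → ℝ) (D : Fin n → Fin m → S) (σ : ℝ)
    (batch : ℕ → ℕ → Fin n → Ω → Batch m b) : Prop where
  unbiased : ∀ k t i x,
    ∫ ω, stochGrad loss D i (batch k t i ω) x ∂μ = gradient (localLoss loss D i) x
  variance : ∀ k t i x,
    ∫ ω, ‖stochGrad loss D i (batch k t i ω) x - gradient (localLoss loss D i) x‖ ^ 2 ∂μ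
      ≤ σ ^ 2 / b

end

end PISCO

/-!
The argument follows four squared errors per round, in expectation: the consensus error
`‖X - X J‖²`, the disagreement `‖Y - Y J‖²` of the gradient trackers, the drift of the models during
the local updates, and the squared gradient `‖∇f(x̄)‖²` at the average model `x̄`. Write
`τ = T_o + 1`,
`λ = λ_p`, `β = L η τ` and `κ = L η_l τ`; the step sizes give `β ≤ λ² / 180` and `κ ≤ β / λ`.

Averages are preserved by mixing and by tracking, so a round moves `x̄` by `-η` times the sum of
`τ` averaged stochastic gradients. As `f` is smooth and the noise of every draw is orthogonal to
everything drawn before, this yields a descent inequality (`Run.Valid.integral_f_round_le`) whose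
errors are the consensus error, the drift, and the noise `L η² τ s / n` of the average, where
`s = σ² / b`. The factor `1 / n` comes from the pairwise orthogonality of all the noise vectors of a
round (`Run.Valid.integral_norm_avgNoise_sq_le`).

The random mixing matrix contracts disagreement in mean square by `1 - λ`, which Young's inequality
turns into linear recursions with factor `1 - λ / 2`: one for the consensus error, driven by the
summed trackers of the round (`Run.Valid.integral_consensusErr_succ_le`), and one for the trackers,
driven by the change of the stochastic gradients between rounds
(`Run.Valid.integral_trackingErr_succ_le`). Server rounds erase all disagreement, which gives the
noise terms of both recursions their factor `1 - p`. For fixed randomness, the drift is bounded by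
`κ²` times the initial tracker and the noise (`Run.drift_le`).

Summed over the rounds, these inequalities form a coupled linear system whose loop gains are small
multiples of `β² / λ⁴`, and it is solved in `gradient_le_of_coupled`.

Measurability is never an issue for the iterates: mini-batches and server choices have finitely
many values, so each iterate is a function of finitely many discrete random choices
(`FiniteMeasurable`). Independence is used through `integral_freeze`, applied to one random choice
and the `σ`-algebra of all the others.
-/

namespace PISCO

noncomputable section

/-! ### Column matrices, averages and mixing -/

section Columns

variable {d n : ℕ}

/-- The disagreement `X - X J`: every column minus the average of all columns. -/
def disagreement (X : Cols d n) : Cols d n := fun i => X i - avg X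

lemma mix_avgMatrix (X : Cols d n) : mix X (avgMatrix n) = fun _ => avg X := by
  funext j
  simp [mix, avg, avgMatrix, Finset.smul_sum]

lemma sub_mix_avgMatrix (X : Cols d n) : X - mix X (avgMatrix n) = disagreement X := by
  rw [mix_avgMatrix]; rfl

lemma avg_add (X Y : Cols d n) : avg (X + Y) = avg X + avg Y := by
  simp [avg, Finset.sum_add_distrib]

lemma avg_sub (X Y : Cols d n) : avg (X - Y) = avg X - avg Y := by
  simp [avg, Finset.sum_sub_distrib, smul_sub]

lemma avg_smul (c : ℝ) (X : Cols d n) : avg (c • X) = c • avg X := by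
  simp [avg, ← Finset.smul_sum, smul_comm c]

lemma avg_sum {ι : Type*} (s : Finset ι) (X : ι → Cols d n) :
    avg (∑ t ∈ s, X t) = ∑ t ∈ s, avg (X t) := by
  simp only [avg, Finset.sum_apply]
  rw [Finset.sum_comm, Finset.smul_sum]

lemma avg_const (hn : 0 < n) (v : Vec d) : avg (fun _ : Fin n => v) = v := by
  have : (n : ℝ) ≠ 0 := by positivity
  simp [avg, ← Nat.cast_smul_eq_nsmul ℝ, smul_smul, this]

lemma disagreement_add (X Y : Cols d n) :
    disagreement (X + Y) = disagreement X + disagreement Y := by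
  funext i; simp only [disagreement, avg_add, Pi.add_apply]; abel

lemma disagreement_sub (X Y : Cols d n) :
    disagreement (X - Y) = disagreement X - disagreement Y := by
  funext i; simp only [disagreement, avg_sub, Pi.sub_apply]; abel

lemma disagreement_smul (c : ℝ) (X : Cols d n) :
    disagreement (c • X) = c • disagreement X := by
  funext i; simp [disagreement, avg_smul, smul_sub]

lemma mix_add (X Y : Cols d n) (A : Matrix (Fin n) (Fin n) ℝ) :
    mix (X + Y) A = mix X A + mix Y A := by
  funext j; simp [mix, Finset.sum_add_distrib]

lemma mix_sub_right (X : Cols d n) (A B : Matrix (Fin n) (Fin n) ℝ) :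
    mix X (A - B) = mix X A - mix X B := by
  funext j; simp [mix, sub_smul, Finset.sum_sub_distrib]

lemma frobSq_nonneg (X : Cols d n) : 0 ≤ frobSq X :=
  Finset.sum_nonneg fun _ _ => sq_nonneg _

lemma frobSq_smul (c : ℝ) (X : Cols d n) : frobSq (c • X) = c ^ 2 * frobSq X := by
  simp [frobSq, norm_smul, mul_pow, Finset.mul_sum]

lemma frobSq_neg (X : Cols d n) : frobSq (-X) = frobSq X := by
  simp [frobSq]

lemma norm_sum_sq_le {E ι : Type*} [NormedAddCommGroup E] (s : Finset ι) (v : ι → E) :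
    ‖∑ t ∈ s, v t‖ ^ 2 ≤ s.card * ∑ t ∈ s, ‖v t‖ ^ 2 :=
  (pow_le_pow_left₀ (norm_nonneg _) (norm_sum_le _ _) 2).trans sq_sum_le_card_mul_sum_sq

lemma frobSq_sum_le {ι : Type*} (s : Finset ι) (X : ι → Cols d n) :
    frobSq (∑ t ∈ s, X t) ≤ s.card * ∑ t ∈ s, frobSq (X t) := by
  simp only [frobSq, Finset.sum_apply]
  rw [Finset.sum_comm, Finset.mul_sum]
  exact Finset.sum_le_sum fun i _ => norm_sum_sq_le s _

lemma norm_add_sq_le {E : Type*} [NormedAddCommGroup E] (a b : E) {c : ℝ} (hc : 0 < c) :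
    ‖a + b‖ ^ 2 ≤ (1 + c) * ‖a‖ ^ 2 + (1 + 1 / c) * ‖b‖ ^ 2 := by
  have h1 := pow_le_pow_left₀ (norm_nonneg _) (norm_add_le a b) 2
  have h2 : 2 * ‖a‖ * ‖b‖ ≤ c * ‖a‖ ^ 2 + 1 / c * ‖b‖ ^ 2 := by
    have h3 : c * ‖a‖ ^ 2 + 1 / c * ‖b‖ ^ 2 - 2 * ‖a‖ * ‖b‖ = (c * ‖a‖ - ‖b‖) ^ 2 / c := by
      field_simp; ring
    have : 0 ≤ (c * ‖a‖ - ‖b‖) ^ 2 / c := by positivity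
    linarith
  nlinarith

/-- Young's inequality for the squared Frobenius norm. -/
lemma frobSq_add_le (X Y : Cols d n) {c : ℝ} (hc : 0 < c) :
    frobSq (X + Y) ≤ (1 + c) * frobSq X + (1 + 1 / c) * frobSq Y := by
  simp only [frobSq, Finset.mul_sum, ← Finset.sum_add_distrib]
  exact Finset.sum_le_sum fun i _ => norm_add_sq_le _ _ hc

lemma frobSq_add_sub_le (X Y Z : Cols d n) :
    frobSq (X + (Y - Z)) ≤ 3 * (frobSq X + frobSq Y + frobSq Z) := by
  have h := frobSq_sum_le Finset.univ ![X, Y, -Z]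
  simp only [Fin.sum_univ_three, Finset.card_univ, Fintype.card_fin, Matrix.cons_val_zero,
    Matrix.cons_val_one, Matrix.cons_val, frobSq_neg] at h
  calc frobSq (X + (Y - Z)) = frobSq (X + Y + -Z) := by congr 1; abel
    _ ≤ _ := by simpa using h

lemma frobSq_add_add_sub_le (X Y Z V : Cols d n) :
    frobSq (X + Y + (Z - V)) ≤ 4 * (frobSq X + frobSq Y + frobSq Z + frobSq V) := by
  have h := frobSq_sum_le Finset.univ ![X, Y, Z, -V]
  simp only [Fin.sum_univ_four, Finset.card_univ, Fintype.card_fin, Matrix.cons_val_zero,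
    Matrix.cons_val_one, Matrix.cons_val, frobSq_neg] at h
  calc frobSq (X + Y + (Z - V)) = frobSq (X + Y + Z + -V) := by congr 1; abel
    _ ≤ _ := by simpa using h

lemma sum_disagreement (hn : 0 < n) (X : Cols d n) : ∑ i, disagreement X i = 0 := by
  have : (n : ℝ) ≠ 0 := by positivity
  simp [disagreement, avg, Finset.sum_sub_distrib, ← Nat.cast_smul_eq_nsmul ℝ, smul_smul, this]

/-- Pythagoras for the orthogonal decomposition into average and disagreement. -/
lemma frobSq_eq (hn : 0 < n) (X : Cols d n) :
    frobSq X = frobSq (disagreement X) + n * ‖avg X‖ ^ 2 := by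
  have h : ∀ i, ‖X i‖ ^ 2 = ‖disagreement X i‖ ^ 2 + 2 * inner ℝ (disagreement X i) (avg X)
      + ‖avg X‖ ^ 2 := by
    intro i
    rw [← norm_add_sq_real]; simp [disagreement]
  simp only [frobSq, h, Finset.sum_add_distrib, ← Finset.mul_sum, ← sum_inner,
    sum_disagreement hn X]
  simp

lemma frobSq_disagreement_le (hn : 0 < n) (X : Cols d n) :
    frobSq (disagreement X) ≤ frobSq X := by
  rw [frobSq_eq hn X]; have : 0 ≤ n * ‖avg X‖ ^ 2 := by positivity
  linarith

lemma norm_avg_sq_le (hn : 0 < n) (X : Cols d n) : n * ‖avg X‖ ^ 2 ≤ frobSq X := by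
  rw [frobSq_eq hn X]; linarith [frobSq_nonneg (disagreement X)]

lemma star_toEuclideanCLM_apply (A : Matrix (Fin n) (Fin n) ℝ) (v : EuclideanSpace ℝ (Fin n))
    (j : Fin n) :
    (star (Matrix.toEuclideanCLM (n := Fin n) (𝕜 := ℝ) A) v) j = ∑ i, A i j * v i := by
  rw [← map_star, Matrix.ofLp_toEuclideanCLM]
  simp [Matrix.mulVec, dotProduct, Matrix.star_apply]

lemma frobSq_mix_le (X : Cols d n) (A : Matrix (Fin n) (Fin n) ℝ) :
    frobSq (mix X A) ≤ ‖Matrix.toEuclideanCLM (n := Fin n) (𝕜 := ℝ) A‖ ^ 2 * frobSq X := by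
  -- The columns of `X` are combined by `Aᵀ`, one coordinate of `ℝ^d` at a time.
  have hcoord : ∀ v : EuclideanSpace ℝ (Fin n),
      ∑ j, (∑ i, A i j * v i) ^ 2
        ≤ ‖Matrix.toEuclideanCLM (n := Fin n) (𝕜 := ℝ) A‖ ^ 2 * ∑ i, v i ^ 2 := by
    intro v
    have h := (star (Matrix.toEuclideanCLM (n := Fin n) (𝕜 := ℝ) A)).le_opNorm v
    rw [norm_star (Matrix.toEuclideanCLM (n := Fin n) (𝕜 := ℝ) A)] at h
    have h2 := pow_le_pow_left₀ (norm_nonneg _) h 2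
    rw [mul_pow, EuclideanSpace.norm_sq_eq, EuclideanSpace.norm_sq_eq] at h2
    simpa only [Real.norm_eq_abs, sq_abs, star_toEuclideanCLM_apply] using h2
  have hfrob : ∀ Y : Cols d n, frobSq Y = ∑ l, ∑ i, (Y i l) ^ 2 := by
    intro Y
    simp only [frobSq, EuclideanSpace.norm_sq_eq, Real.norm_eq_abs, sq_abs]
    exact Finset.sum_comm
  rw [hfrob, hfrob, Finset.mul_sum]
  refine Finset.sum_le_sum fun l _ => ?_
  have h := hcoord (WithLp.toLp 2 fun i => X i l)
  simpa [mix] using h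

variable {W : Matrix (Fin n) (Fin n) ℝ}

lemma avg_mix (hW : W ∈ doublyStochastic ℝ (Fin n)) (X : Cols d n) : avg (mix X W) = avg X := by
  simp only [avg, mix]
  rw [Finset.sum_comm]
  simp_rw [← Finset.sum_smul, sum_row_of_mem_doublyStochastic hW, one_smul]

lemma avgMatrix_mem_doublyStochastic (hn : 0 < n) :
    avgMatrix n ∈ doublyStochastic ℝ (Fin n) := by
  have : (n : ℝ) ≠ 0 := by positivity
  rw [mem_doublyStochastic_iff_sum]
  refine ⟨fun i j => ?_, fun i => ?_, fun i => ?_⟩ <;> simp [avgMatrix, this]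

lemma disagreement_mix (hn : 0 < n) (hW : W ∈ doublyStochastic ℝ (Fin n)) (X : Cols d n) :
    disagreement (mix X W) = mix (disagreement X) (W - avgMatrix n) := by
  have h1 : disagreement (mix X W) = mix X (W - avgMatrix n) := by
    rw [mix_sub_right, mix_avgMatrix]
    funext i; simp [disagreement, avg_mix hW]
  rw [h1]
  funext j
  have hn' : (n : ℝ) ≠ 0 := by positivity
  have hcol : ∑ i, (W - avgMatrix n) i j = 0 := by
    simp [avgMatrix, Finset.sum_sub_distrib, sum_col_of_mem_doublyStochastic hW, hn']
  simp only [mix, disagreement, smul_sub, Finset.sum_sub_distrib, ← Finset.sum_smul, hcol]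
  simp

lemma frobSq_mix_doublyStochastic_le (hW : W ∈ doublyStochastic ℝ (Fin n)) (X : Cols d n) :
    frobSq (mix X W) ≤ frobSq X := by
  have hcol : ∀ j, ‖∑ i, W i j • X i‖ ^ 2 ≤ ∑ i, W i j * ‖X i‖ ^ 2 := by
    intro j
    have hc : ConvexOn ℝ Set.univ (fun v : Vec d => ‖v‖ ^ 2) :=
      convexOn_univ_norm.pow (fun _ _ => norm_nonneg _) 2
    have := hc.map_sum_le (t := Finset.univ) (w := fun i => W i j) (p := X)
      (fun i _ => nonneg_of_mem_doublyStochastic hW)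
      (sum_col_of_mem_doublyStochastic hW j) (fun _ _ => Set.mem_univ _)
    simpa using this
  calc frobSq (mix X W) ≤ ∑ j, ∑ i, W i j * ‖X i‖ ^ 2 := Finset.sum_le_sum fun j _ => hcol j
    _ = frobSq X := by
      rw [Finset.sum_comm]
      simp_rw [← Finset.sum_mul, sum_row_of_mem_doublyStochastic hW, one_mul]
      rfl

lemma frobSq_disagreement_mix_le (hn : 0 < n) (hW : W ∈ doublyStochastic ℝ (Fin n))
    (X : Cols d n) :
    frobSq (disagreement (mix X W)) ≤ (1 - mixingRate W) * frobSq (disagreement X) := by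
  rw [disagreement_mix hn hW]
  simpa [mixingRate] using frobSq_mix_le (disagreement X) (W - avgMatrix n)

lemma frobSq_disagreement_mix_le_frobSq (hn : 0 < n) (hW : W ∈ doublyStochastic ℝ (Fin n))
    (X : Cols d n) : frobSq (disagreement (mix X W)) ≤ frobSq X :=
  (frobSq_disagreement_le hn _).trans (frobSq_mix_doublyStochastic_le hW X)

lemma disagreement_mix_avgMatrix (hn : 0 < n) (X : Cols d n) :
    disagreement (mix X (avgMatrix n)) = 0 := by
  rw [mix_avgMatrix]; funext i; simp [disagreement, avg_const hn]

/-- The mixing rate is nonnegative: `‖W - J‖₂ ≤ 1` for doubly stochastic `W`. -/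
lemma mixingRate_nonneg (hn : 0 < n) (hW : W ∈ doublyStochastic ℝ (Fin n)) :
    0 ≤ mixingRate W := by
  have key : ‖Matrix.toEuclideanCLM (n := Fin n) (𝕜 := ℝ) (W - avgMatrix n)‖ ≤ 1 := by
    rw [← norm_star]
    refine ContinuousLinearMap.opNorm_le_bound _ zero_le_one fun v => ?_
    rw [one_mul]
    refine (sq_le_sq₀ (norm_nonneg _) (norm_nonneg _)).1 ?_
    -- `(W - J)ᵀ v` is the disagreement of `v W`, for `v` a matrix with one row.
    have h := frobSq_disagreement_mix_le_frobSq hn hW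
      (fun i => (WithLp.toLp 2 fun _ => v i : Vec 1))
    rw [EuclideanSpace.norm_sq_eq, EuclideanSpace.norm_sq_eq]
    have h1 : disagreement (mix (fun i => (WithLp.toLp 2 fun _ => v i : Vec 1)) W)
        = mix (fun i => (WithLp.toLp 2 fun _ => v i : Vec 1)) (W - avgMatrix n) := by
      rw [mix_sub_right, mix_avgMatrix]
      funext i; simp [disagreement, avg_mix hW]
    rw [h1] at h
    simp only [frobSq, mix, EuclideanSpace.norm_sq_eq] at h
    simp only [star_toEuclideanCLM_apply]
    simpa using h
  have : ‖Matrix.toEuclideanCLM (n := Fin n) (𝕜 := ℝ) (W - avgMatrix n)‖ ^ 2 ≤ 1 :=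
    pow_le_one₀ (norm_nonneg _) key
  unfold mixingRate; linarith

lemma one_sub_expectedMixingRate (W : Matrix (Fin n) (Fin n) ℝ) (p : ℝ) :
    1 - expectedMixingRate W p = (1 - p) * (1 - mixingRate W) := by
  unfold expectedMixingRate; ring

lemma mixingRate_le_one (W : Matrix (Fin n) (Fin n) ℝ) : mixingRate W ≤ 1 := by
  unfold mixingRate
  linarith [sq_nonneg ‖Matrix.toEuclideanCLM (n := Fin n) (𝕜 := ℝ) (W - avgMatrix n)‖]

end Columns

/-! ### Random elements with finitely many values -/

section FiniteRange

variable {Ω A B : Type*} {ℱ 𝒢 m0 : MeasurableSpace Ω}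

/-- `u` takes finitely many values and is measurable from `ℱ` to the discrete `σ`-algebra of its
codomain: `u` is a random element determined by the information `ℱ`. As no structure on the
codomain is used, every function of such elements is again one. -/
def FiniteMeasurable (ℱ : MeasurableSpace Ω) (u : Ω → A) : Prop :=
  (Set.range u).Finite ∧ ∀ s : Set A, MeasurableSet[ℱ] (u ⁻¹' s)

lemma FiniteMeasurable.mono {u : Ω → A} (hu : FiniteMeasurable ℱ u) (h : ℱ ≤ 𝒢) :
    FiniteMeasurable 𝒢 u :=
  ⟨hu.1, fun s => h _ (hu.2 s)⟩

lemma FiniteMeasurable.comp {u : Ω → A} (hu : FiniteMeasurable ℱ u) (φ : A → B) :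
    FiniteMeasurable ℱ (fun ω => φ (u ω)) := by
  refine ⟨?_, fun s => hu.2 (φ ⁻¹' s)⟩
  have : Set.range (fun ω => φ (u ω)) = φ '' Set.range u := by
    rw [← Set.range_comp]; rfl
  rw [this]
  exact hu.1.image φ

lemma finiteMeasurable_const (a : A) : FiniteMeasurable ℱ (fun _ => a) :=
  ⟨(Set.finite_singleton a).subset (by rintro _ ⟨_, rfl⟩; rfl), fun s => by
    by_cases h : a ∈ s <;> simp [Set.preimage, h]⟩

lemma FiniteMeasurable.prodMk {u : Ω → A} {v : Ω → B} (hu : FiniteMeasurable ℱ u)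
    (hv : FiniteMeasurable ℱ v) : FiniteMeasurable ℱ (fun ω => (u ω, v ω)) := by
  refine ⟨(hu.1.prod hv.1).subset ?_, fun s => ?_⟩
  · rintro _ ⟨ω, rfl⟩
    exact ⟨⟨ω, rfl⟩, ⟨ω, rfl⟩⟩
  · have : (fun ω => (u ω, v ω)) ⁻¹' s
        = ⋃ a ∈ Set.range u, u ⁻¹' {a} ∩ v ⁻¹' {b | (a, b) ∈ s} := by
      ext ω
      simp only [Set.mem_preimage, Set.mem_iUnion, Set.mem_inter_iff, Set.mem_singleton_iff,
        Set.mem_ofPred_eq, Set.mem_range, exists_prop]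
      constructor
      · exact fun h => ⟨u ω, ⟨ω, rfl⟩, rfl, h⟩
      · rintro ⟨_, _, rfl, h⟩; exact h
    rw [this]
    exact hu.1.measurableSet_biUnion fun a _ => (hu.2 _).inter (hv.2 _)

lemma FiniteMeasurable.sum {E ι : Type*} [AddCommMonoid E] (s : Finset ι) {u : ι → Ω → E}
    (hu : ∀ i, FiniteMeasurable ℱ (u i)) : FiniteMeasurable ℱ (fun ω => ∑ i ∈ s, u i ω) := by
  classical
  induction s using Finset.induction_on with
  | empty => simpa using finiteMeasurable_const 0
  | insert a s ha ih =>
    simp only [Finset.sum_insert ha]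
    exact ((hu a).prodMk ih).comp fun q => q.1 + q.2

lemma finiteMeasurable_of_measurable [Finite A] [MeasurableSpace A] [DiscreteMeasurableSpace A]
    {u : Ω → A} (hu : Measurable[ℱ] u) : FiniteMeasurable ℱ u :=
  ⟨Set.toFinite _, fun _ => hu (MeasurableSet.of_discrete)⟩

lemma FiniteMeasurable.measurable [MeasurableSpace A] {u : Ω → A} (hu : FiniteMeasurable ℱ u) :
    Measurable[ℱ] u :=
  fun s _ => hu.2 s

variable {μ : Measure Ω} [IsProbabilityMeasure μ]

lemma FiniteMeasurable.integrable {E : Type*} [NormedAddCommGroup E] {u : Ω → E}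
    (hu : FiniteMeasurable m0 u) : Integrable u μ := by
  obtain ⟨C, hC⟩ := (hu.1.image norm).bddAbove
  refine Integrable.of_bound (C := C) ?_ (.of_forall fun ω => hC ⟨_, ⟨ω, rfl⟩, rfl⟩)
  exact (SimpleFunc.mk u (fun x => hu.2 {x}) hu.1).aestronglyMeasurable

/-- Freezing: an expectation over independent `U` and `Z` can be taken first over `Z`, with the
value of `U` held fixed, and then over `U`. -/
lemma integral_freeze (hℱ : ℱ ≤ m0) (h𝒢 : 𝒢 ≤ m0) (hind : Indep ℱ 𝒢 μ) {U : Ω → A} {Z : Ω → B}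
    (hU : FiniteMeasurable ℱ U) (hZ : FiniteMeasurable 𝒢 Z) (φ : A → B → ℝ) :
    ∫ ω, φ (U ω) (Z ω) ∂μ = ∫ ω, ∫ ω', φ (U ω) (Z ω') ∂μ ∂μ := by
  classical
  have hsum : ∀ (F : A → ℝ) (ω : Ω),
      F (U ω) = ∑ a ∈ hU.1.toFinset, (if U ω = a then (1 : ℝ) else 0) * F a := by
    intro F ω
    simp only [ite_mul, one_mul, zero_mul]
    rw [Finset.sum_ite_eq, if_pos (by simp)]
  have hprod : ∀ a, ∫ ω, (if U ω = a then (1 : ℝ) else 0) * φ a (Z ω) ∂μ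
      = (∫ ω, (if U ω = a then (1 : ℝ) else 0) ∂μ) * ∫ ω, φ a (Z ω) ∂μ := by
    intro a
    have h1 : FiniteMeasurable ℱ (fun ω => if U ω = a then (1 : ℝ) else 0) :=
      hU.comp fun u => if u = a then (1 : ℝ) else 0
    have h2 : FiniteMeasurable 𝒢 (fun ω => φ a (Z ω)) := hZ.comp (φ a)
    refine IndepFun.integral_fun_mul_eq_mul_integral ?_
      (h1.mono hℱ).integrable.aestronglyMeasurable (h2.mono h𝒢).integrable.aestronglyMeasurable
    exact indep_of_indep_of_le_left (indep_of_indep_of_le_right hind h2.measurable.comap_le)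
      h1.measurable.comap_le
  have hint : ∀ a, Integrable (fun ω => (if U ω = a then (1 : ℝ) else 0) * φ a (Z ω)) μ :=
    fun a => (((hU.mono hℱ).prodMk (hZ.mono h𝒢)).comp
      fun q => (if q.1 = a then (1 : ℝ) else 0) * φ a q.2).integrable
  have hint' : ∀ a, Integrable
      (fun ω => (if U ω = a then (1 : ℝ) else 0) * ∫ ω', φ a (Z ω') ∂μ) μ :=
    fun a => ((hU.mono hℱ).comp
      fun u => (if u = a then (1 : ℝ) else 0) * ∫ ω', φ a (Z ω') ∂μ).integrable
  calc ∫ ω, φ (U ω) (Z ω) ∂μ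
      = ∫ ω, ∑ a ∈ hU.1.toFinset, (if U ω = a then (1 : ℝ) else 0) * φ a (Z ω) ∂μ := by
        congr 1; funext ω; exact hsum (fun a => φ a (Z ω)) ω
    _ = ∑ a ∈ hU.1.toFinset,
          ∫ ω, (if U ω = a then (1 : ℝ) else 0) * ∫ ω', φ a (Z ω') ∂μ ∂μ := by
        rw [integral_finsetSum _ fun a _ => hint a]
        refine Finset.sum_congr rfl fun a _ => ?_
        rw [hprod, integral_mul_const]
    _ = ∫ ω, ∫ ω', φ (U ω) (Z ω') ∂μ ∂μ := by
        rw [← integral_finsetSum _ fun a _ => hint' a]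
        congr 1; funext ω; exact (hsum (fun a => ∫ ω', φ a (Z ω') ∂μ) ω).symm

/-- The second moment of a sum of pairwise orthogonal random vectors is additive. -/
lemma integral_norm_sum_sq {ι E : Type*} [NormedAddCommGroup E] [InnerProductSpace ℝ E]
    [DecidableEq ι] (s : Finset ι) (v : ι → Ω → E) (hv : ∀ i ∈ s, FiniteMeasurable m0 (v i))
    (hortho : ∀ i ∈ s, ∀ j ∈ s, i ≠ j → ∫ ω, inner ℝ (v i ω) (v j ω) ∂μ = 0) :
    ∫ ω, ‖∑ i ∈ s, v i ω‖ ^ 2 ∂μ = ∑ i ∈ s, ∫ ω, ‖v i ω‖ ^ 2 ∂μ := by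
  have hint : ∀ i ∈ s, ∀ j ∈ s, Integrable (fun ω => inner ℝ (v i ω) (v j ω)) μ :=
    fun i hi j hj => (((hv i hi).prodMk (hv j hj)).comp fun q => inner ℝ q.1 q.2).integrable
  simp_rw [← real_inner_self_eq_norm_sq, sum_inner, inner_sum]
  rw [integral_finsetSum _ fun i hi => integrable_finsetSum _ fun j hj => hint i hi j hj]
  refine Finset.sum_congr rfl fun i hi => ?_
  rw [integral_finsetSum _ fun j hj => hint i hi j hj]
  exact Finset.sum_eq_single i (fun j hj hji => hortho i hi j hj hji.symm) (fun h => (h hi).elim)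

end FiniteRange

/-! ### Smooth objectives -/

section Smooth

variable {d n m : ℕ} {S : Type*} {loss : Vec d → S → ℝ} {D : Fin n → Fin m → S} {L : ℝ}

/-- The matrix `[∇f_1(x_1), …, ∇f_n(x_n)]` of exact local gradients at `X`. -/
def localGrads (loss : Vec d → S → ℝ) (D : Fin n → Fin m → S) (X : Cols d n) : Cols d n :=
  fun i => gradient (localLoss loss D i) (X i)

/-- The quadratic upper bound of a smooth function. The mean value inequality gives it with the
constant `L` in place of the sharp `L / 2`. -/
lemma IsLSmooth.le_add {g : Vec d → ℝ} (hL : 0 ≤ L) (hg : IsLSmooth g L) (x y : Vec d) :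
    g y ≤ g x + inner ℝ (gradient g x) (y - x) + L * ‖y - x‖ ^ 2 := by
  have h := (convex_segment x y).norm_image_sub_le_of_norm_fderiv_le' (𝕜 := ℝ) (f := g)
    (φ := fderiv ℝ g x) (C := L * ‖y - x‖) (fun z _ => hg.differentiable z)
    (fun z hz => ?_) (left_mem_segment ℝ x y) (right_mem_segment ℝ x y)
  · have h2 : inner ℝ (gradient g x) (y - x) = fderiv ℝ g x (y - x) := by
      simp [gradient]
    rw [h2]
    have := (abs_le.1 h).2
    nlinarith
  · have h1 : ‖fderiv ℝ g z - fderiv ℝ g x‖ = ‖gradient g z - gradient g x‖ := by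
      simp only [gradient, ← map_sub, LinearIsometryEquiv.norm_map]
    rw [h1]
    refine (hg.lipschitz z x).trans (mul_le_mul_of_nonneg_left ?_ hL)
    obtain ⟨c, hc, rfl⟩ := (segment_eq_image' ℝ x y ▸ hz :)
    simp only [add_sub_cancel_left, norm_smul, Real.norm_eq_abs, abs_of_nonneg hc.1]
    exact mul_le_of_le_one_left (norm_nonneg _) hc.2

lemma differentiable_globalLoss (h : ∀ i, IsLSmooth (localLoss loss D i) L) :
    Differentiable ℝ (globalLoss loss D) := by
  unfold globalLoss
  exact (Differentiable.fun_sum fun i _ => (h i).differentiable).const_mul _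

lemma gradient_globalLoss (h : ∀ i, IsLSmooth (localLoss loss D i) L) (x : Vec d) :
    gradient (globalLoss loss D) x = avg (localGrads loss D fun _ => x) := by
  have h1 : fderiv ℝ (globalLoss loss D) x
      = (1 / (n : ℝ)) • ∑ i, fderiv ℝ (localLoss loss D i) x := by
    have hd : HasFDerivAt (globalLoss loss D)
        ((1 / (n : ℝ)) • ∑ i, fderiv ℝ (localLoss loss D i) x) x := by
      unfold globalLoss
      exact (HasFDerivAt.fun_sum fun i _ =>
        ((h i).differentiable x).hasFDerivAt).const_mul (1 / (n : ℝ))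
    exact hd.fderiv
  simp [gradient, h1, avg, localGrads, map_sum]

lemma frobSq_localGrads_sub_le (h : ∀ i, IsLSmooth (localLoss loss D i) L)
    (X Y : Cols d n) :
    frobSq (localGrads loss D X - localGrads loss D Y) ≤ L ^ 2 * frobSq (X - Y) := by
  simp only [frobSq, Finset.mul_sum, ← mul_pow]
  exact Finset.sum_le_sum fun i _ =>
    pow_le_pow_left₀ (norm_nonneg _) ((h i).lipschitz (X i) (Y i)) 2

lemma norm_gradient_sub_avg_sq_le (hn : 0 < n) (h : ∀ i, IsLSmooth (localLoss loss D i) L)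
    (v : Vec d) (X : Cols d n) :
    n * ‖gradient (globalLoss loss D) v - avg (localGrads loss D X)‖ ^ 2
      ≤ L ^ 2 * frobSq ((fun _ => v) - X) := by
  rw [gradient_globalLoss h, ← avg_sub]
  exact (norm_avg_sq_le hn _).trans (frobSq_localGrads_sub_le h _ _)

lemma isLSmooth_globalLoss (hn : 0 < n) (hL : 0 ≤ L)
    (h : ∀ i, IsLSmooth (localLoss loss D i) L) : IsLSmooth (globalLoss loss D) L := by
  refine ⟨differentiable_globalLoss h, fun x y => ?_⟩
  have h1 := norm_gradient_sub_avg_sq_le hn h x (fun _ => y)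
  rw [← gradient_globalLoss h] at h1
  have h2 : frobSq ((fun _ : Fin n => x) - fun _ => y) = n * ‖x - y‖ ^ 2 := by
    simp [frobSq]
  rw [h2] at h1
  have hn' : (0 : ℝ) < n := by positivity
  refine (sq_le_sq₀ (norm_nonneg _) (by positivity)).1 ?_
  rw [mul_pow]
  refine le_of_mul_le_mul_left ?_ hn'
  linarith

end Smooth

/-! ### Trajectories of the algorithm -/

/-- The data of a run of the algorithm on a sample space `Ω`. -/
structure Run (Ω S : Type*) (d n m b : ℕ) where
  /-- The loss of a single sample. -/
  loss : Vec d → S → ℝ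
  /-- The data sets of the agents. -/
  D : Fin n → Fin m → S
  /-- The mixing matrix of gossip rounds. -/
  W : Matrix (Fin n) (Fin n) ℝ
  /-- The number of local updates of a round. -/
  To : ℕ
  /-- The communication step size. -/
  ηc : ℝ
  /-- The local step size. -/
  ηl : ℝ
  /-- The common initial model. -/
  x0 : Vec d
  /-- Whether a round uses the server. -/
  server : ℕ → Ω → Bool
  /-- The mini-batches. -/
  batch : ℕ → ℕ → Fin n → Ω → Batch m b

namespace Run

variable {Ω S : Type*} {d n m b : ℕ} (R : Run Ω S d n m b)

/-- The global objective of the run. -/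
def f (x : Vec d) : ℝ := globalLoss R.loss R.D x

/-- The effective step size `η = η_c η_l`. -/
def η : ℝ := R.ηc * R.ηl

/-- The number `T_o + 1` of trackers that are summed up in a round. -/
def τ : ℕ := R.To + 1

/-- The state at the beginning of round `k`. -/
def state (k : ℕ) (ω : Ω) : State d n :=
  iterates R.loss R.D R.W R.To R.ηc R.ηl R.x0 (fun j => R.server j ω)
    (fun j t i => R.batch j t i ω) k

/-- The state in round `k` after `t` local updates. -/
def traj (k t : ℕ) (ω : Ω) : State d n :=
  localIter R.loss R.D R.ηl (fun t i => R.batch k t i ω) (R.state k ω) t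

/-- The models in round `k` after `t` local updates. -/
def X (k t : ℕ) (ω : Ω) : Cols d n := (R.traj k t ω).X

/-- The gradient trackers in round `k` after `t` local updates. -/
def Y (k t : ℕ) (ω : Ω) : Cols d n := (R.traj k t ω).Y

/-- The exact local gradients in round `k` after `t` local updates. -/
def H (k t : ℕ) (ω : Ω) : Cols d n := localGrads R.loss R.D (R.X k t ω)

/-- The noise of the stochastic gradients in round `k` after `t` local updates. -/
def noise (k t : ℕ) (ω : Ω) : Cols d n :=
  stochGrads R.loss R.D (fun i => R.batch k t i ω) (R.X k t ω) - R.H k t ω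

/-- The mixing matrix of round `k`. -/
def mixer (k : ℕ) (ω : Ω) : Matrix (Fin n) (Fin n) ℝ :=
  if R.server k ω then avgMatrix n else R.W

lemma traj_G (k t : ℕ) (ω : Ω) : (R.traj k t ω).G = R.H k t ω + R.noise k t ω := by
  rw [noise, add_sub_cancel]
  cases t with
  | zero => cases k <;> rfl
  | succ t => rfl

lemma X_succ (k t : ℕ) (ω : Ω) : R.X k (t + 1) ω = R.X k t ω - R.ηl • R.Y k t ω := rfl

lemma Y_succ (k t : ℕ) (ω : Ω) :
    R.Y k (t + 1) ω = R.Y k t ω + (R.H k (t + 1) ω + R.noise k (t + 1) ω)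
      - (R.H k t ω + R.noise k t ω) := by
  rw [← R.traj_G, ← R.traj_G]; rfl

/-- Within a round the tracker differs from its initial value by the change of the stochastic
gradients. -/
lemma Y_eq (k t : ℕ) (ω : Ω) :
    R.Y k t ω = R.Y k 0 ω + (R.H k t ω - R.H k 0 ω) + (R.noise k t ω - R.noise k 0 ω) := by
  induction t with
  | zero => simp
  | succ t ih => rw [Y_succ, ih]; abel

lemma X_sub_X_zero (k t : ℕ) (ω : Ω) :
    R.X k t ω - R.X k 0 ω = -(R.ηl • ∑ s ∈ Finset.range t, R.Y k s ω) := by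
  induction t with
  | zero => simp
  | succ t ih =>
    rw [X_succ, Finset.sum_range_succ, smul_add, neg_add, ← ih]; abel

/-- A round subtracts `η` times the sum of all `τ` trackers of the round, and mixes. -/
lemma X_round (k : ℕ) (ω : Ω) :
    R.X (k + 1) 0 ω
      = mix (R.X k 0 ω - R.η • ∑ t ∈ Finset.range R.τ, R.Y k t ω) (R.mixer k ω) := by
  have h : R.X (k + 1) 0 ω = mix ((1 - R.ηc) • R.X k 0 ω
      + R.ηc • (R.X k R.To ω - R.ηl • R.Y k R.To ω)) (R.mixer k ω) := rfl
  rw [h]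
  congr 1
  have h2 := R.X_sub_X_zero k (R.To + 1) ω
  rw [X_succ, sub_eq_iff_eq_add] at h2
  rw [h2, τ, η, mul_smul, smul_add, sub_smul, one_smul, smul_neg]
  abel

lemma Y_round (k : ℕ) (ω : Ω) :
    R.Y (k + 1) 0 ω = mix (R.Y k 0 ω + ((R.H (k + 1) 0 ω - R.H k 0 ω)
      + (R.noise (k + 1) 0 ω - R.noise k 0 ω))) (R.mixer k ω) := by
  have h : R.Y (k + 1) 0 ω = mix (R.Y k R.To ω + (R.traj (k + 1) 0 ω).G - (R.traj k R.To ω).G)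
      (R.mixer k ω) := rfl
  rw [h, traj_G, traj_G, R.Y_eq k R.To]
  congr 1
  abel

variable {R}

lemma mixer_mem (hn : 0 < n) (hW : R.W ∈ doublyStochastic ℝ (Fin n)) (k : ℕ) (ω : Ω) :
    R.mixer k ω ∈ doublyStochastic ℝ (Fin n) := by
  unfold mixer
  split_ifs
  · exact avgMatrix_mem_doublyStochastic hn
  · exact hW

/-- The average of the trackers is the average of the current stochastic gradients. -/
lemma avg_Y (hn : 0 < n) (hW : R.W ∈ doublyStochastic ℝ (Fin n)) (k t : ℕ) (ω : Ω) :
    avg (R.Y k t ω) = avg (R.H k t ω) + avg (R.noise k t ω) := by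
  have h0 : avg (R.Y k 0 ω) = avg (R.H k 0 ω) + avg (R.noise k 0 ω) := by
    induction k with
    | zero => rw [← avg_add, ← R.traj_G]; rfl
    | succ k ih =>
      rw [Y_round, avg_mix (mixer_mem hn hW k ω)]
      simp only [avg_add, avg_sub, ih]
      abel
  rw [Y_eq]
  simp only [avg_add, avg_sub, h0]
  abel

lemma avg_X_round (hn : 0 < n) (hW : R.W ∈ doublyStochastic ℝ (Fin n)) (k : ℕ) (ω : Ω) :
    avg (R.X (k + 1) 0 ω) = avg (R.X k 0 ω)
      - R.η • (∑ t ∈ Finset.range R.τ, avg (R.H k t ω)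
        + ∑ t ∈ Finset.range R.τ, avg (R.noise k t ω)) := by
  rw [X_round, avg_mix (mixer_mem hn hW k ω), avg_sub, avg_smul, avg_sum,
    ← Finset.sum_add_distrib]
  simp only [avg_Y hn hW]

variable (R)

/-- The squared consensus error at the beginning of round `k`. -/
def consensusErr (k : ℕ) (ω : Ω) : ℝ := frobSq (disagreement (R.X k 0 ω))

/-- The squared disagreement of the gradient trackers at the beginning of round `k`. -/
def trackingErr (k : ℕ) (ω : Ω) : ℝ := frobSq (disagreement (R.Y k 0 ω))

/-- The squared norm of the global gradient at the average model of round `k`. -/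
def gradSq (k : ℕ) (ω : Ω) : ℝ := ‖gradient (globalLoss R.loss R.D) (avg (R.X k 0 ω))‖ ^ 2

/-- The squared distances from the initial models of round `k`, summed over the local updates. -/
def drift (k : ℕ) (ω : Ω) : ℝ := ∑ t ∈ Finset.range R.τ, frobSq (R.X k t ω - R.X k 0 ω)

/-- The noise that enters the trackers in round `k`: that of every local update, and that of the
initial stochastic gradients, which all trackers of the round contain. -/
def noiseSq (k : ℕ) (ω : Ω) : ℝ :=
  ∑ t ∈ Finset.range R.τ, frobSq (R.noise k t ω) + R.τ * frobSq (R.noise k 0 ω)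

/-- The noise of the average model in round `k`. -/
def avgNoise (k : ℕ) (ω : Ω) : Vec d := ∑ t ∈ Finset.range R.τ, avg (R.noise k t ω)

variable {R} {L : ℝ}

lemma consensusErr_nonneg (k : ℕ) (ω : Ω) : 0 ≤ R.consensusErr k ω := frobSq_nonneg _

lemma trackingErr_nonneg (k : ℕ) (ω : Ω) : 0 ≤ R.trackingErr k ω := frobSq_nonneg _

lemma gradSq_nonneg (k : ℕ) (ω : Ω) : 0 ≤ R.gradSq k ω := sq_nonneg _

lemma drift_nonneg (k : ℕ) (ω : Ω) : 0 ≤ R.drift k ω :=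
  Finset.sum_nonneg fun _ _ => frobSq_nonneg _

lemma consensusErr_zero (hn : 0 < n) (ω : Ω) : R.consensusErr 0 ω = 0 := by
  have h : R.X 0 0 ω = fun _ => R.x0 := rfl
  simp [consensusErr, h, disagreement, avg_const hn, frobSq]

lemma frobSq_Y_le (hf : ∀ i, IsLSmooth (localLoss R.loss R.D i) L) (k t : ℕ) (ω : Ω) :
    frobSq (R.Y k t ω) ≤ 4 * (frobSq (R.Y k 0 ω) + L ^ 2 * frobSq (R.X k t ω - R.X k 0 ω)
      + frobSq (R.noise k t ω) + frobSq (R.noise k 0 ω)) := by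
  rw [R.Y_eq k t ω]
  refine (frobSq_add_add_sub_le _ _ _ _).trans ?_
  have := frobSq_localGrads_sub_le hf (R.X k t ω) (R.X k 0 ω)
  unfold H
  linarith

lemma sum_tracker_bound (k : ℕ) (ω : Ω) (y : ℝ) :
    ∑ t ∈ Finset.range R.τ, 4 * (y + L ^ 2 * frobSq (R.X k t ω - R.X k 0 ω)
      + frobSq (R.noise k t ω) + frobSq (R.noise k 0 ω))
      = 4 * (R.τ * y + L ^ 2 * R.drift k ω + R.noiseSq k ω) := by
  simp only [← Finset.mul_sum, Finset.sum_add_distrib, Finset.sum_const, Finset.card_range,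
    nsmul_eq_mul, drift, noiseSq]
  ring

/-- The drift is controlled by the initial tracker and the noise: its own contribution to the
later trackers has a factor `4 κ² ≤ 1 / 2`, for `κ = L η_l τ`, and is absorbed. -/
lemma drift_le (hf : ∀ i, IsLSmooth (localLoss R.loss R.D i) L)
    (hκ : (L * R.ηl * R.τ) ^ 2 ≤ 1 / 8) (k : ℕ) (ω : Ω) :
    L ^ 2 * R.drift k ω
      ≤ 8 * (L * R.ηl * R.τ) ^ 2 * (R.τ * frobSq (R.Y k 0 ω) + R.noiseSq k ω) := by
  have h1 : ∀ t ∈ Finset.range R.τ, frobSq (R.X k t ω - R.X k 0 ω)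
      ≤ R.ηl ^ 2 * (R.τ * ∑ s ∈ Finset.range R.τ, frobSq (R.Y k s ω)) := by
    intro t ht
    rw [X_sub_X_zero, frobSq_neg, frobSq_smul]
    refine mul_le_mul_of_nonneg_left ((frobSq_sum_le _ _).trans ?_) (sq_nonneg _)
    have ht' := (Finset.mem_range.1 ht).le
    rw [Finset.card_range]
    have hsub : Finset.range t ⊆ Finset.range R.τ := Finset.range_subset_range.2 ht'
    have hsum := Finset.sum_le_sum_of_subset_of_nonneg hsub
      (f := fun s => frobSq (R.Y k s ω)) fun _ _ _ => frobSq_nonneg _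
    exact mul_le_mul (by exact_mod_cast ht') hsum
      (Finset.sum_nonneg fun _ _ => frobSq_nonneg _) (by positivity)
  have h2 : R.drift k ω
      ≤ (R.ηl * R.τ) ^ 2 * ∑ s ∈ Finset.range R.τ, frobSq (R.Y k s ω) := by
    refine (Finset.sum_le_sum h1).trans (le_of_eq ?_)
    rw [Finset.sum_const, Finset.card_range, nsmul_eq_mul]; ring
  have h3 : ∑ s ∈ Finset.range R.τ, frobSq (R.Y k s ω)
      ≤ 4 * (R.τ * frobSq (R.Y k 0 ω) + L ^ 2 * R.drift k ω + R.noiseSq k ω) :=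
    (Finset.sum_le_sum fun t _ => frobSq_Y_le hf k t ω).trans (sum_tracker_bound k ω _).le
  have h4 : L ^ 2 * R.drift k ω ≤ (L * R.ηl * R.τ) ^ 2
      * (4 * (R.τ * frobSq (R.Y k 0 ω) + L ^ 2 * R.drift k ω + R.noiseSq k ω)) := by
    calc L ^ 2 * R.drift k ω
        ≤ L ^ 2 * ((R.ηl * R.τ) ^ 2 * ∑ s ∈ Finset.range R.τ, frobSq (R.Y k s ω)) :=
          mul_le_mul_of_nonneg_left h2 (sq_nonneg _)
      _ = (L * R.ηl * R.τ) ^ 2 * ∑ s ∈ Finset.range R.τ, frobSq (R.Y k s ω) := by ring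
      _ ≤ _ := mul_le_mul_of_nonneg_left h3 (sq_nonneg _)
  have h5 : 0 ≤ L ^ 2 * R.drift k ω := mul_nonneg (sq_nonneg _) (drift_nonneg k ω)
  nlinarith

lemma frobSq_Y_zero_le (hn : 0 < n) (hW : R.W ∈ doublyStochastic ℝ (Fin n))
    (hf : ∀ i, IsLSmooth (localLoss R.loss R.D i) L) (k : ℕ) (ω : Ω) :
    frobSq (R.Y k 0 ω) ≤ R.trackingErr k ω + 3 * (n * R.gradSq k ω + L ^ 2 * R.consensusErr k ω
      + frobSq (R.noise k 0 ω)) := by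
  rw [frobSq_eq hn, avg_Y hn hW]
  have h1 := norm_gradient_sub_avg_sq_le hn hf (avg (R.X k 0 ω)) (R.X k 0 ω)
  have h2 := norm_avg_sq_le hn (R.noise k 0 ω)
  have h3 : frobSq ((fun _ => avg (R.X k 0 ω)) - R.X k 0 ω) = R.consensusErr k ω := by
    rw [← frobSq_neg, neg_sub]; rfl
  rw [h3] at h1
  set g := gradient (globalLoss R.loss R.D) (avg (R.X k 0 ω))
  have h4 := norm_sum_sq_le Finset.univ ![g, -(g - avg (R.H k 0 ω)), avg (R.noise k 0 ω)]
  simp only [Fin.sum_univ_three, Finset.card_univ, Fintype.card_fin, Matrix.cons_val_zero,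
    Matrix.cons_val_one, Matrix.cons_val, norm_neg] at h4
  have h5 : g + -(g - avg (R.H k 0 ω)) + avg (R.noise k 0 ω)
      = avg (R.H k 0 ω) + avg (R.noise k 0 ω) := by abel
  rw [h5] at h4
  have h6 := mul_le_mul_of_nonneg_left h4 (Nat.cast_nonneg (α := ℝ) n)
  have h7 : R.gradSq k ω = ‖g‖ ^ 2 := rfl
  have h8 : R.trackingErr k ω = frobSq (disagreement (R.Y k 0 ω)) := rfl
  have h9 : R.H k 0 ω = localGrads R.loss R.D (R.X k 0 ω) := rfl
  rw [h7, h8]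
  rw [h9] at h6 ⊢
  push_cast at h6
  linarith

/-- The deviation of the average local gradients from the global gradient at the average model is
controlled by the consensus error and the drift. -/
lemma sum_gradient_sub_avg_le (hn : 0 < n) (hf : ∀ i, IsLSmooth (localLoss R.loss R.D i) L)
    (k : ℕ) (ω : Ω) :
    n * ∑ t ∈ Finset.range R.τ,
        ‖gradient (globalLoss R.loss R.D) (avg (R.X k 0 ω)) - avg (R.H k t ω)‖ ^ 2
      ≤ 2 * L ^ 2 * (R.τ * R.consensusErr k ω + R.drift k ω) := by
  have h : ∀ t, n * ‖gradient (globalLoss R.loss R.D) (avg (R.X k 0 ω)) - avg (R.H k t ω)‖ ^ 2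
      ≤ L ^ 2 * (2 * (R.consensusErr k ω + frobSq (R.X k t ω - R.X k 0 ω))) := by
    intro t
    refine (norm_gradient_sub_avg_sq_le hn hf _ _).trans
      (mul_le_mul_of_nonneg_left ?_ (sq_nonneg _))
    have h1 : (fun _ => avg (R.X k 0 ω)) - R.X k t ω
        = -(disagreement (R.X k 0 ω) + (R.X k t ω - R.X k 0 ω)) := by
      funext i; simp [disagreement]
    rw [h1, frobSq_neg]
    refine (frobSq_add_le _ _ one_pos).trans (le_of_eq ?_)
    unfold consensusErr
    ring
  rw [Finset.mul_sum]
  refine (Finset.sum_le_sum fun t _ => h t).trans (le_of_eq ?_)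
  simp only [← Finset.mul_sum, Finset.sum_add_distrib, Finset.sum_const, Finset.card_range,
    nsmul_eq_mul, drift]
  ring

lemma frobSq_disagreement_sum_Y_le (hn : 0 < n)
    (hf : ∀ i, IsLSmooth (localLoss R.loss R.D i) L) (k : ℕ) (ω : Ω) :
    frobSq (disagreement (∑ t ∈ Finset.range R.τ, R.Y k t ω))
      ≤ 4 * R.τ * (R.τ * R.trackingErr k ω + L ^ 2 * R.drift k ω + R.noiseSq k ω) := by
  have hsum : disagreement (∑ t ∈ Finset.range R.τ, R.Y k t ω)
      = ∑ t ∈ Finset.range R.τ, disagreement (R.Y k t ω) := by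
    funext i
    simp [disagreement, avg_sum, Finset.sum_sub_distrib]
  have h : ∀ t, frobSq (disagreement (R.Y k t ω)) ≤ 4 * (R.trackingErr k ω
      + L ^ 2 * frobSq (R.X k t ω - R.X k 0 ω) + frobSq (R.noise k t ω)
      + frobSq (R.noise k 0 ω)) := by
    intro t
    rw [R.Y_eq k t ω, disagreement_add, disagreement_add, disagreement_sub (R.noise k t ω)]
    refine (frobSq_add_add_sub_le _ _ _ _).trans ?_
    have h1 := (frobSq_disagreement_le hn (R.H k t ω - R.H k 0 ω)).trans
      (frobSq_localGrads_sub_le hf (R.X k t ω) (R.X k 0 ω))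
    have h2 := frobSq_disagreement_le hn (R.noise k t ω)
    have h3 := frobSq_disagreement_le hn (R.noise k 0 ω)
    unfold trackingErr
    linarith
  rw [hsum]
  refine (frobSq_sum_le _ _).trans ?_
  rw [Finset.card_range]
  calc (R.τ : ℝ) * ∑ t ∈ Finset.range R.τ, frobSq (disagreement (R.Y k t ω))
      ≤ R.τ * (4 * (R.τ * R.trackingErr k ω + L ^ 2 * R.drift k ω + R.noiseSq k ω)) :=
        mul_le_mul_of_nonneg_left
          ((Finset.sum_le_sum fun t _ => h t).trans (sum_tracker_bound k ω _).le) (by positivity)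
    _ = _ := by ring

/-- The descent inequality of one round, for a fixed realization. -/
lemma f_round_le (hn : 0 < n) (hW : R.W ∈ doublyStochastic ℝ (Fin n)) (hL : 0 ≤ L)
    (hf : ∀ i, IsLSmooth (localLoss R.loss R.D i) L) (hη : 0 ≤ R.η)
    (hβ : 4 * (L * R.η * R.τ) ≤ 1) (k : ℕ) (ω : Ω) :
    R.f (avg (R.X (k + 1) 0 ω)) ≤ R.f (avg (R.X k 0 ω)) - R.η * R.τ / 2 * R.gradSq k ω
      + R.η * L ^ 2 / n * (R.τ * R.consensusErr k ω + R.drift k ω)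
      + 2 * L * R.η ^ 2 * ‖R.avgNoise k ω‖ ^ 2
      - R.η * inner ℝ (gradient (globalLoss R.loss R.D) (avg (R.X k 0 ω))) (R.avgNoise k ω) := by
  have hn' : (0 : ℝ) < n := by positivity
  have h1 := (isLSmooth_globalLoss hn hL hf).le_add hL (avg (R.X k 0 ω)) (avg (R.X (k + 1) 0 ω))
  have h2 : avg (R.X (k + 1) 0 ω) - avg (R.X k 0 ω)
      = -(R.η • (∑ t ∈ Finset.range R.τ, avg (R.H k t ω) + R.avgNoise k ω)) := by
    rw [avg_X_round hn hW]; unfold avgNoise; abel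
  have h3 := sum_gradient_sub_avg_le hn hf k ω
  have h7 : R.gradSq k ω = ‖gradient (globalLoss R.loss R.D) (avg (R.X k 0 ω))‖ ^ 2 := rfl
  rw [h2] at h1
  rw [norm_neg, norm_smul, mul_pow, Real.norm_eq_abs, sq_abs, inner_neg_right,
    real_inner_smul_right, inner_add_right, inner_sum] at h1
  set g := gradient (globalLoss R.loss R.D) (avg (R.X k 0 ω))
  have h4 : ∑ t ∈ Finset.range R.τ, inner ℝ g (avg (R.H k t ω))
      = R.τ / 2 * ‖g‖ ^ 2 + 1 / 2 * ∑ t ∈ Finset.range R.τ, ‖avg (R.H k t ω)‖ ^ 2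
        - 1 / 2 * ∑ t ∈ Finset.range R.τ, ‖g - avg (R.H k t ω)‖ ^ 2 := by
    simp only [norm_sub_sq_real, Finset.sum_add_distrib, Finset.sum_sub_distrib,
      ← Finset.mul_sum, Finset.sum_const, Finset.card_range, nsmul_eq_mul]
    ring
  rw [h4] at h1
  have h5 := norm_add_sq_le (∑ t ∈ Finset.range R.τ, avg (R.H k t ω)) (R.avgNoise k ω) one_pos
  have h6 := norm_sum_sq_le (Finset.range R.τ) fun t => avg (R.H k t ω)
  rw [Finset.card_range] at h6
  have h8 : ∑ t ∈ Finset.range R.τ, ‖g - avg (R.H k t ω)‖ ^ 2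
      ≤ 2 * L ^ 2 * (R.τ * R.consensusErr k ω + R.drift k ω) / n := by
    rw [le_div_iff₀ hn']; linarith
  set a := ∑ t ∈ Finset.range R.τ, ‖avg (R.H k t ω)‖ ^ 2
  have ha : 0 ≤ a := Finset.sum_nonneg fun _ _ => sq_nonneg _
  set q := ‖∑ t ∈ Finset.range R.τ, avg (R.H k t ω) + R.avgNoise k ω‖ ^ 2
  have hq : q ≤ 2 * (R.τ * a) + 2 * ‖R.avgNoise k ω‖ ^ 2 := by linarith only [h5, h6]
  have h9 : L * (R.η ^ 2 * q) ≤ L * (R.η ^ 2 * (2 * (R.τ * a) + 2 * ‖R.avgNoise k ω‖ ^ 2)) :=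
    mul_le_mul_of_nonneg_left (mul_le_mul_of_nonneg_left hq (sq_nonneg _)) hL
  have h10 : 4 * (L * R.η * R.τ) * (R.η * a / 2) ≤ 1 * (R.η * a / 2) :=
    mul_le_mul_of_nonneg_right hβ (div_nonneg (mul_nonneg hη ha) two_pos.le)
  have h11 := mul_le_mul_of_nonneg_left h8 hη
  have h12 : R.η * (2 * L ^ 2 * (R.τ * R.consensusErr k ω + R.drift k ω) / n)
    = 2 * (R.η * L ^ 2 / n * (R.τ * R.consensusErr k ω + R.drift k ω)) := by ring
  rw [h12] at h11
  rw [h7]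
  unfold f
  linarith only [h1, h9, h10, h11]

/-- The squared length of a global step. -/
lemma frobSq_X_round_sub_le (hn : 0 < n) (hW : R.W ∈ doublyStochastic ℝ (Fin n))
    (hf : ∀ i, IsLSmooth (localLoss R.loss R.D i) L) (k : ℕ) (ω : Ω) :
    frobSq (R.X (k + 1) 0 ω - R.X k 0 ω)
      ≤ 2 * R.consensusErr (k + 1) ω + 2 * R.consensusErr k ω
        + R.η ^ 2 * (2 * n * ‖R.avgNoise k ω‖ ^ 2 + 4 * R.τ ^ 2 * (n * R.gradSq k ω)
          + 8 * R.τ * L ^ 2 * (R.τ * R.consensusErr k ω + R.drift k ω)) := by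
  rw [frobSq_eq hn, disagreement_sub, avg_sub]
  have h1 := frobSq_add_le (disagreement (R.X (k + 1) 0 ω)) (-disagreement (R.X k 0 ω)) one_pos
  rw [frobSq_neg, ← sub_eq_add_neg] at h1
  have h2 : avg (R.X (k + 1) 0 ω) - avg (R.X k 0 ω)
      = -(R.η • (∑ t ∈ Finset.range R.τ, avg (R.H k t ω) + R.avgNoise k ω)) := by
    rw [avg_X_round hn hW]; unfold avgNoise; abel
  rw [h2, norm_neg, norm_smul, mul_pow, Real.norm_eq_abs, sq_abs]
  have h3 := sum_gradient_sub_avg_le hn hf k ω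
  have h5 := norm_add_sq_le (∑ t ∈ Finset.range R.τ, avg (R.H k t ω)) (R.avgNoise k ω) one_pos
  have h6 := norm_sum_sq_le (Finset.range R.τ) fun t => avg (R.H k t ω)
  rw [Finset.card_range] at h6
  have h7 : R.gradSq k ω = ‖gradient (globalLoss R.loss R.D) (avg (R.X k 0 ω))‖ ^ 2 := rfl
  set g := gradient (globalLoss R.loss R.D) (avg (R.X k 0 ω))
  have h8 : ∑ t ∈ Finset.range R.τ, ‖avg (R.H k t ω)‖ ^ 2
      ≤ 2 * (R.τ * ‖g‖ ^ 2) + 2 * ∑ t ∈ Finset.range R.τ, ‖g - avg (R.H k t ω)‖ ^ 2 := by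
    have : ∀ t ∈ Finset.range R.τ, ‖avg (R.H k t ω)‖ ^ 2
        ≤ 2 * ‖g‖ ^ 2 + 2 * ‖g - avg (R.H k t ω)‖ ^ 2 := by
      intro t _
      have := norm_add_sq_le g (-(g - avg (R.H k t ω))) one_pos
      rw [norm_neg] at this
      calc ‖avg (R.H k t ω)‖ ^ 2 = ‖g + -(g - avg (R.H k t ω))‖ ^ 2 := by congr 2; abel
        _ ≤ _ := by linarith
    refine (Finset.sum_le_sum this).trans (le_of_eq ?_)
    simp only [Finset.sum_add_distrib, ← Finset.mul_sum, Finset.sum_const, Finset.card_range,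
      nsmul_eq_mul]
  set a := ∑ t ∈ Finset.range R.τ, ‖avg (R.H k t ω)‖ ^ 2
  set e := ∑ t ∈ Finset.range R.τ, ‖g - avg (R.H k t ω)‖ ^ 2
  set q := ‖∑ t ∈ Finset.range R.τ, avg (R.H k t ω) + R.avgNoise k ω‖ ^ 2
  have hτ : (0 : ℝ) ≤ R.τ := by positivity
  have hn0 : (0 : ℝ) ≤ n := by positivity
  have h9 : n * q ≤ 2 * n * ‖R.avgNoise k ω‖ ^ 2 + 4 * R.τ ^ 2 * (n * R.gradSq k ω)
          + 8 * R.τ * L ^ 2 * (R.τ * R.consensusErr k ω + R.drift k ω) := by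
    have ha := mul_le_mul_of_nonneg_left h8 (mul_nonneg hn0 hτ)
    have hb := mul_le_mul_of_nonneg_left h3 hτ
    have hc := mul_le_mul_of_nonneg_left (h5.trans (add_le_add_left
      (mul_le_mul_of_nonneg_left h6 (by norm_num)) _)) hn0
    rw [h7]
    linarith
  have h10 := mul_le_mul_of_nonneg_left h9 (sq_nonneg R.η)
  unfold consensusErr at *
  linarith

end Run

namespace Run

/-! ### The information generated by the random choices -/

section Information

variable {Ω S : Type*} {d n m b : ℕ} (R : Run Ω S d n m b)

/-- The `σ`-algebra of a single random choice: the server choice of a round (`Sum.inl k`) or one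
mini-batch of one agent (`Sum.inr (k, t, i)`). -/
abbrev choice : ℕ ⊕ ℕ × ℕ × Fin n → MeasurableSpace Ω :=
  Sum.elim (fun k : ℕ => MeasurableSpace.comap (R.server k) inferInstance)
    (fun q : ℕ × ℕ × Fin n => MeasurableSpace.comap (R.batch q.1 q.2.1 q.2.2) inferInstance)

/-- The information contained in a set of random choices. -/
abbrev info (T : Set (ℕ ⊕ ℕ × ℕ × Fin n)) : MeasurableSpace Ω := ⨆ q ∈ T, R.choice q

/-- The random choices that precede the mini-batches number `t` of round `k`. -/
def past (n k t : ℕ) : Set (ℕ ⊕ ℕ × ℕ × Fin n) :=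
  {q | Sum.elim (fun j => j < k) (fun r => r.1 < k ∨ r.1 = k ∧ r.2.1 < t) q}

lemma inl_mem_past {n j k t : ℕ} : Sum.inl j ∈ past n k t ↔ j < k := Iff.rfl

lemma inr_mem_past {n k t : ℕ} {r : ℕ × ℕ × Fin n} :
    Sum.inr r ∈ past n k t ↔ r.1 < k ∨ r.1 = k ∧ r.2.1 < t := Iff.rfl

lemma past_mono {n k t t' : ℕ} (h : t ≤ t') : past n k t ⊆ past n k t' := by
  rintro (j | r) hq
  · exact hq
  · rw [inr_mem_past] at *; omega

lemma past_subset_succ {n k t : ℕ} : past n k t ⊆ past n (k + 1) 0 := by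
  rintro (j | r) hq
  · rw [inl_mem_past] at *; omega
  · rw [inr_mem_past] at *; omega

lemma past_subset_compl_inl {n k t : ℕ} : past n k t ⊆ {Sum.inl k}ᶜ := by
  rintro q hq rfl
  exact lt_irrefl _ (inl_mem_past.1 hq)

lemma past_subset_compl_inr {n k t : ℕ} {i : Fin n} : past n k t ⊆ {Sum.inr (k, t, i)}ᶜ := by
  rintro q hq rfl
  rw [inr_mem_past] at hq
  simp at hq

variable {R}

lemma info_mono {T T' : Set (ℕ ⊕ ℕ × ℕ × Fin n)} (h : T ⊆ T') : R.info T ≤ R.info T' :=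
  biSup_mono fun _ hq => h hq

lemma choice_le_info {T : Set (ℕ ⊕ ℕ × ℕ × Fin n)} {q} (h : q ∈ T) : R.choice q ≤ R.info T :=
  le_biSup R.choice h

variable {T : Set (ℕ ⊕ ℕ × ℕ × Fin n)}

lemma finiteMeasurable_server {k : ℕ} (h : Sum.inl k ∈ T) :
    FiniteMeasurable (R.info T) (R.server k) :=
  (finiteMeasurable_of_measurable (comap_measurable (R.server k))).mono
    (choice_le_info (R := R) h)

lemma finiteMeasurable_batch {k t : ℕ} {i : Fin n} (h : Sum.inr (k, t, i) ∈ T) :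
    FiniteMeasurable (R.info T) (R.batch k t i) :=
  (finiteMeasurable_of_measurable (comap_measurable (R.batch k t i))).mono
    (choice_le_info (R := R) h)

lemma finiteMeasurable_batches {k t : ℕ} (h : ∀ i, Sum.inr (k, t, i) ∈ T) :
    FiniteMeasurable (R.info T) (fun ω i => R.batch k t i ω) :=
  finiteMeasurable_of_measurable
    (@measurable_pi_lambda _ _ _ (R.info T) _ _ fun i => (finiteMeasurable_batch (h i)).measurable)

lemma finiteMeasurable_traj_of_zero {k : ℕ}
    (h : FiniteMeasurable (R.info (past n k 1)) (R.traj k 0)) (t : ℕ) :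
    FiniteMeasurable (R.info (past n k (t + 1))) (R.traj k t) := by
  induction t with
  | zero => exact h
  | succ t ih =>
    have hb : FiniteMeasurable (R.info (past n k (t + 1 + 1)))
        (fun ω i => R.batch k (t + 1) i ω) :=
      finiteMeasurable_batches fun i => Or.inr ⟨rfl, Nat.lt_succ_self _⟩
    exact ((ih.mono (info_mono (past_mono (Nat.le_succ _)))).prodMk hb).comp
      fun q => localStep R.loss R.D R.ηl q.2 q.1

lemma finiteMeasurable_X_zero_and_traj_zero (k : ℕ) :
    FiniteMeasurable (R.info (past n k 0)) (R.X k 0) ∧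
      FiniteMeasurable (R.info (past n k 1)) (R.traj k 0) := by
  have hb : ∀ k, FiniteMeasurable (R.info (past n k 1)) (fun ω i => R.batch k 0 i ω) :=
    fun k => finiteMeasurable_batches fun i => Or.inr ⟨rfl, Nat.lt_succ_self _⟩
  induction k with
  | zero =>
    refine ⟨finiteMeasurable_const _, (hb 0).comp fun Z => (State.mk (fun _ => R.x0)
      (stochGrads R.loss R.D Z fun _ => R.x0) (stochGrads R.loss R.D Z fun _ => R.x0) :
        State d n)⟩
  | succ k ih =>
    have hs : FiniteMeasurable (R.info (past n (k + 1) 0)) (R.server k) :=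
      finiteMeasurable_server (Nat.lt_succ_self k)
    have h0 := ih.2.mono (info_mono (R := R) past_subset_succ)
    have hT := (finiteMeasurable_traj_of_zero ih.2 R.To).mono
      (info_mono (R := R) past_subset_succ)
    have h := (h0.prodMk hT).prodMk hs
    constructor
    · exact h.comp fun q => mix ((1 - R.ηc) • q.1.1.X + R.ηc • (q.1.2.X - R.ηl • q.1.2.Y))
        (if q.2 then avgMatrix n else R.W)
    · exact ((h.mono (info_mono (R := R) (past_mono zero_le_one))).prodMk (hb (k + 1))).comp
        fun q => commStep R.loss R.D R.ηc R.ηl (if q.1.2 then avgMatrix n else R.W) q.2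
          q.1.1.1 q.1.1.2

lemma finiteMeasurable_traj (k t : ℕ) :
    FiniteMeasurable (R.info (past n k (t + 1))) (R.traj k t) :=
  finiteMeasurable_traj_of_zero (finiteMeasurable_X_zero_and_traj_zero k).2 t

/-- The models are determined before the mini-batches at which they are evaluated are drawn. -/
lemma finiteMeasurable_X (k t : ℕ) : FiniteMeasurable (R.info (past n k t)) (R.X k t) := by
  cases t with
  | zero => exact (finiteMeasurable_X_zero_and_traj_zero k).1
  | succ t => exact (finiteMeasurable_traj k t).comp fun s => s.X - R.ηl • s.Y

lemma finiteMeasurable_noise_apply {k t : ℕ} {i : Fin n} (h : past n k t ⊆ T)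
    (hi : Sum.inr (k, t, i) ∈ T) :
    FiniteMeasurable (R.info T) (fun ω => R.noise k t ω i) :=
  (((finiteMeasurable_X k t).mono (info_mono h)).prodMk (finiteMeasurable_batch hi)).comp
    fun q => stochGrad R.loss R.D i q.2 (q.1 i) - gradient (localLoss R.loss R.D i) (q.1 i)

end Information

end Run

namespace Run

/-! ### Assumptions and integrability -/

section Expectation

variable {Ω S : Type*} [m0 : MeasurableSpace Ω] {d n m b : ℕ}

/-- The assumptions on a run: network, smoothness, sampling and noise, with noise level `s`. -/
structure Valid (R : Run Ω S d n m b) (μ : Measure Ω) (p L s : ℝ) : Prop where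
  n_pos : 0 < n
  mixing : R.W ∈ doublyStochastic ℝ (Fin n)
  p_nonneg : 0 ≤ p
  p_le_one : p ≤ 1
  L_pos : 0 < L
  smooth : ∀ i, IsLSmooth (localLoss R.loss R.D i) L
  sampling : IsSampling μ p R.server R.batch
  unbiased : ∀ k t i x,
    ∫ ω, stochGrad R.loss R.D i (R.batch k t i ω) x ∂μ = gradient (localLoss R.loss R.D i) x
  variance : ∀ k t i x,
    ∫ ω, ‖stochGrad R.loss R.D i (R.batch k t i ω) x - gradient (localLoss R.loss R.D i) x‖ ^ 2 ∂μ
      ≤ s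

namespace Valid

variable {R : Run Ω S d n m b} {μ : Measure Ω} {p L s : ℝ}

section Integrability

variable (h : R.Valid μ p L s)
include h

lemma choice_le (q : ℕ ⊕ ℕ × ℕ × Fin n) : R.choice q ≤ m0 := by
  cases q with
  | inl k => exact (h.sampling.measurable_server k).comap_le
  | inr r => exact (h.sampling.measurable_batch r.1 r.2.1 r.2.2).comap_le

lemma expectedMixingRate_le_one : expectedMixingRate R.W p ≤ 1 := by
  have h1 := one_sub_expectedMixingRate R.W p
  have h2 := mul_nonneg (sub_nonneg.2 h.p_le_one) (sub_nonneg.2 (mixingRate_le_one R.W))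
  linarith

lemma one_sub_expectedMixingRate_le : 1 - expectedMixingRate R.W p ≤ 1 - p := by
  rw [one_sub_expectedMixingRate]
  have h1 := mixingRate_nonneg h.n_pos h.mixing
  exact mul_le_of_le_one_right (sub_nonneg.2 h.p_le_one) (by linarith)

lemma info_le (T : Set (ℕ ⊕ ℕ × ℕ × Fin n)) : R.info T ≤ m0 := iSup₂_le fun q _ => h.choice_le q

lemma indep_info_compl (q : ℕ ⊕ ℕ × ℕ × Fin n) : Indep (R.info {q}ᶜ) (R.info {q}) μ :=
  indep_iSup_of_disjoint h.choice_le h.sampling.indep disjoint_compl_left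

lemma finiteMeasurable_traj (k t : ℕ) : FiniteMeasurable m0 (R.traj k t) :=
  (Run.finiteMeasurable_traj k t).mono (h.info_le _)

lemma finiteMeasurable_noise (k t : ℕ) : FiniteMeasurable m0 (R.noise k t) := by
  have : R.noise k t = fun ω => (R.traj k t ω).G - localGrads R.loss R.D (R.traj k t ω).X := by
    funext ω; rw [R.traj_G]; simp [H, X]
  rw [this]
  exact (h.finiteMeasurable_traj k t).comp fun q => q.G - localGrads R.loss R.D q.X

lemma finiteMeasurable_consensusErr (k : ℕ) : FiniteMeasurable m0 (R.consensusErr k) :=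
  (h.finiteMeasurable_traj k 0).comp fun q => frobSq (disagreement q.X)

lemma finiteMeasurable_trackingErr (k : ℕ) : FiniteMeasurable m0 (R.trackingErr k) :=
  (h.finiteMeasurable_traj k 0).comp fun q => frobSq (disagreement q.Y)

lemma finiteMeasurable_gradSq (k : ℕ) : FiniteMeasurable m0 (R.gradSq k) :=
  (h.finiteMeasurable_traj k 0).comp
    fun q => ‖gradient (globalLoss R.loss R.D) (avg q.X)‖ ^ 2

lemma finiteMeasurable_drift (k : ℕ) : FiniteMeasurable m0 (R.drift k) :=
  FiniteMeasurable.sum _ fun t =>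
    ((h.finiteMeasurable_traj k t).prodMk (h.finiteMeasurable_traj k 0)).comp
      fun q => frobSq (q.1.X - q.2.X)

lemma finiteMeasurable_avgNoise (k : ℕ) : FiniteMeasurable m0 (R.avgNoise k) :=
  FiniteMeasurable.sum _ fun t => (h.finiteMeasurable_noise k t).comp avg

variable [IsProbabilityMeasure μ]

lemma integrable_frobSq_noise (k t : ℕ) : Integrable (fun ω => frobSq (R.noise k t ω)) μ :=
  ((h.finiteMeasurable_noise k t).comp frobSq).integrable

lemma integrable_norm_noise_sq (k t : ℕ) (i : Fin n) :
    Integrable (fun ω => ‖R.noise k t ω i‖ ^ 2) μ :=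
  ((h.finiteMeasurable_noise k t).comp fun q => ‖q i‖ ^ 2).integrable

lemma integrable_noiseSq (k : ℕ) : Integrable (R.noiseSq k) μ :=
  (integrable_finsetSum _ fun t _ => h.integrable_frobSq_noise k t).add
    ((h.integrable_frobSq_noise k 0).const_mul _)

lemma integrable_norm_avgNoise_sq (k : ℕ) : Integrable (fun ω => ‖R.avgNoise k ω‖ ^ 2) μ :=
  ((h.finiteMeasurable_avgNoise k).comp fun v => ‖v‖ ^ 2).integrable

end Integrability

/-! ### Moments of the gradient noise -/

section Noise

variable [IsProbabilityMeasure μ] (h : R.Valid μ p L s)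
include h

/-- The conditional variance of the noise given the other random choices is at most `s`. -/
lemma integral_mul_noise_sq_le {k t : ℕ} {i : Fin n} {w : Ω → ℝ}
    (hw : FiniteMeasurable (R.info {Sum.inr (k, t, i)}ᶜ) w) (hw0 : ∀ ω, 0 ≤ w ω) :
    ∫ ω, w ω * ‖R.noise k t ω i‖ ^ 2 ∂μ ≤ s * ∫ ω, w ω ∂μ := by
  have hU := hw.prodMk ((finiteMeasurable_X (R := R) k t).mono (info_mono past_subset_compl_inr))
  have hZ := finiteMeasurable_batch (R := R) (Set.mem_singleton (Sum.inr (k, t, i)))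
  have hfr := integral_freeze (h.info_le _) (h.info_le _) (h.indep_info_compl (Sum.inr (k, t, i)))
    hU hZ fun u z => u.1 * ‖stochGrad R.loss R.D i z (u.2 i)
      - gradient (localLoss R.loss R.D i) (u.2 i)‖ ^ 2
  refine hfr.trans_le ?_
  rw [← integral_const_mul]
  refine integral_mono ((hU.mono (h.info_le _)).comp fun u => ∫ ω', u.1 *
    ‖stochGrad R.loss R.D i (R.batch k t i ω') (u.2 i)
      - gradient (localLoss R.loss R.D i) (u.2 i)‖ ^ 2 ∂μ).integrable
    ((hw.mono (h.info_le _)).integrable.const_mul _) fun ω => ?_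
  simp only [integral_const_mul]
  rw [mul_comm s]
  exact mul_le_mul_of_nonneg_left (h.variance k t i _) (hw0 ω)

lemma integral_noise_sq_le (k t : ℕ) (i : Fin n) : ∫ ω, ‖R.noise k t ω i‖ ^ 2 ∂μ ≤ s := by
  simpa using h.integral_mul_noise_sq_le (k := k) (t := t) (i := i)
    (finiteMeasurable_const (1 : ℝ)) fun _ => zero_le_one

/-- The noise is orthogonal to every random vector determined by the other random choices. -/
lemma integral_inner_noise {k t : ℕ} {i : Fin n} {v : Ω → Vec d}
    (hv : FiniteMeasurable (R.info {Sum.inr (k, t, i)}ᶜ) v) :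
    ∫ ω, inner ℝ (v ω) (R.noise k t ω i) ∂μ = 0 := by
  have hU := hv.prodMk ((finiteMeasurable_X (R := R) k t).mono (info_mono past_subset_compl_inr))
  have hZ := finiteMeasurable_batch (R := R) (Set.mem_singleton (Sum.inr (k, t, i)))
  have hfr := integral_freeze (h.info_le _) (h.info_le _) (h.indep_info_compl (Sum.inr (k, t, i)))
    hU hZ fun u z => inner ℝ u.1 (stochGrad R.loss R.D i z (u.2 i)
      - gradient (localLoss R.loss R.D i) (u.2 i))
  refine hfr.trans ?_
  have h0 : ∀ (a : Vec d) (x : Vec d), ∫ ω', inner ℝ a (stochGrad R.loss R.D i (R.batch k t i ω') x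
      - gradient (localLoss R.loss R.D i) x) ∂μ = 0 := by
    intro a x
    have hi : Integrable (fun ω' => stochGrad R.loss R.D i (R.batch k t i ω') x) μ :=
      ((hZ.mono (h.info_le _)).comp fun z => stochGrad R.loss R.D i z x).integrable
    have hi' : Integrable (fun ω' => stochGrad R.loss R.D i (R.batch k t i ω') x
        - gradient (localLoss R.loss R.D i) x) μ := hi.sub (integrable_const _)
    rw [integral_inner hi', integral_sub hi (integrable_const _),
      h.unbiased]
    simp
  simp [h0]

/-- A server choice is independent of everything else. -/
lemma integral_gossip_mul {k : ℕ} {u : Ω → ℝ} (hu : FiniteMeasurable (R.info {Sum.inl k}ᶜ) u) :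
    ∫ ω, (if R.server k ω then 0 else 1) * u ω ∂μ = (1 - p) * ∫ ω, u ω ∂μ := by
  have hZ := finiteMeasurable_server (R := R) (Set.mem_singleton (Sum.inl k))
  have hfr := integral_freeze (h.info_le _) (h.info_le _) (h.indep_info_compl (Sum.inl k))
    hu hZ fun u z => (if z then 0 else 1) * u
  refine hfr.trans ?_
  have hp : ∫ ω, (if R.server k ω then (0 : ℝ) else 1) ∂μ = 1 - p := by
    have hs : MeasurableSet {ω | R.server k ω = true} :=
      h.sampling.measurable_server k (MeasurableSet.singleton true)
    have : (fun ω => if R.server k ω then (0 : ℝ) else 1)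
        = fun ω => 1 - Set.indicator {ω | R.server k ω = true} 1 ω := by
      funext ω
      by_cases hc : R.server k ω = true <;> simp [hc]
    rw [this, integral_sub (integrable_const _) ((integrable_const _).indicator hs),
      integral_indicator_one hs, h.sampling.server_prob]
    simp
  simp only [integral_mul_const, hp, integral_const_mul]

lemma integral_gossip {k : ℕ} : ∫ ω, (if R.server k ω then (0 : ℝ) else 1) ∂μ = 1 - p := by
  simpa using h.integral_gossip_mul (k := k) (finiteMeasurable_const (1 : ℝ))

lemma integral_frobSq_noise_le (k t : ℕ) : ∫ ω, frobSq (R.noise k t ω) ∂μ ≤ n * s := by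
  unfold frobSq
  rw [integral_finsetSum _ fun i _ => h.integrable_norm_noise_sq k t i]
  refine (Finset.sum_le_sum fun i _ => h.integral_noise_sq_le k t i).trans ?_
  simp

lemma integral_noiseSq_le (k : ℕ) : ∫ ω, R.noiseSq k ω ∂μ ≤ 2 * R.τ * (n * s) := by
  unfold noiseSq
  rw [integral_add (integrable_finsetSum _ fun t _ => h.integrable_frobSq_noise k t)
    ((h.integrable_frobSq_noise k 0).const_mul _),
    integral_finsetSum _ fun t _ => h.integrable_frobSq_noise k t, integral_const_mul]
  have h1 : ∑ t ∈ Finset.range R.τ, ∫ ω, frobSq (R.noise k t ω) ∂μ ≤ R.τ * (n * s) := by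
    refine (Finset.sum_le_sum fun t _ => h.integral_frobSq_noise_le k t).trans ?_
    simp
  have h2 := mul_le_mul_of_nonneg_left (h.integral_frobSq_noise_le k 0)
    (Nat.cast_nonneg (α := ℝ) R.τ)
  linarith

/-- Averaging over the agents reduces the variance, since all noise vectors of a round are
pairwise orthogonal. -/
lemma integral_norm_avgNoise_sq_le (k : ℕ) :
    ∫ ω, ‖R.avgNoise k ω‖ ^ 2 ∂μ ≤ R.τ * s / n := by
  have hn : (0 : ℝ) < n := by exact_mod_cast h.n_pos
  have hsum : ∀ ω, R.avgNoise k ω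
      = (1 / (n : ℝ)) • ∑ q ∈ Finset.range R.τ ×ˢ Finset.univ, R.noise k q.1 ω q.2 := by
    intro ω
    rw [Finset.sum_product, Finset.smul_sum]
    rfl
  have hmeas : ∀ q : ℕ × Fin n, FiniteMeasurable m0 (fun ω => R.noise k q.1 ω q.2) :=
    fun q => (h.finiteMeasurable_noise k q.1).comp fun N => N q.2
  -- Of two different draws, the one that is not earlier is independent of the other.
  have hlt : ∀ q r : ℕ × Fin n, q ≠ r → q.1 ≤ r.1 →
      ∫ ω, inner ℝ (R.noise k q.1 ω q.2) (R.noise k r.1 ω r.2) ∂μ = 0 := by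
    intro q r hqr hle
    refine h.integral_inner_noise (finiteMeasurable_noise_apply
      ((past_mono hle).trans past_subset_compl_inr) ?_)
    intro hc
    simp only [Set.mem_singleton_iff, Sum.inr.injEq, Prod.mk.injEq, true_and] at hc
    exact hqr (Prod.ext hc.1 hc.2)
  have key := integral_norm_sum_sq (μ := μ) (Finset.range R.τ ×ˢ (Finset.univ : Finset (Fin n)))
    (fun q ω => R.noise k q.1 ω q.2) (fun q _ => hmeas q) (fun q _ r _ hqr => by
      rcases le_total q.1 r.1 with hle | hle
      · exact hlt q r hqr hle
      · rw [← hlt r q hqr.symm hle]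
        congr 1; funext ω; exact real_inner_comm _ _)
  simp_rw [hsum, norm_smul, mul_pow]
  rw [integral_const_mul, key]
  have h1 : ∑ q ∈ Finset.range R.τ ×ˢ (Finset.univ : Finset (Fin n)),
      ∫ ω, ‖R.noise k q.1 ω q.2‖ ^ 2 ∂μ ≤ R.τ * n * s := by
    refine (Finset.sum_le_sum fun q _ => h.integral_noise_sq_le k q.1 q.2).trans ?_
    simp [Finset.card_product]
  calc ‖1 / (n : ℝ)‖ ^ 2 * _ ≤ ‖1 / (n : ℝ)‖ ^ 2 * (R.τ * n * s) :=
        mul_le_mul_of_nonneg_left h1 (sq_nonneg _)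
    _ = R.τ * s / n := by
      rw [Real.norm_eq_abs, sq_abs]; field_simp

/-- The average model is determined before any mini-batch of its round is drawn. -/
lemma integral_inner_gradient_avgNoise (k : ℕ) :
    ∫ ω, inner ℝ (gradient (globalLoss R.loss R.D) (avg (R.X k 0 ω))) (R.avgNoise k ω) ∂μ = 0 := by
  have hg : ∀ (t : ℕ) (i : Fin n), FiniteMeasurable (R.info {Sum.inr (k, t, i)}ᶜ)
      (fun ω => gradient (globalLoss R.loss R.D) (avg (R.X k 0 ω))) := fun t i =>
    ((finiteMeasurable_X (R := R) k 0).mono (info_mono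
      ((past_mono (Nat.zero_le t)).trans past_subset_compl_inr))).comp
        fun x => gradient (globalLoss R.loss R.D) (avg x)
  have hint : ∀ (t : ℕ) (i : Fin n), Integrable (fun ω => inner ℝ
      (gradient (globalLoss R.loss R.D) (avg (R.X k 0 ω))) (R.noise k t ω i)) μ := fun t i =>
    ((((hg t i).mono (h.info_le _)).prodMk (h.finiteMeasurable_noise k t)).comp
      fun q => inner ℝ q.1 (q.2 i)).integrable
  have hN : ∀ ω, R.avgNoise k ω
      = ∑ t ∈ Finset.range R.τ, (1 / (n : ℝ)) • ∑ i, R.noise k t ω i := fun ω => rfl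
  simp_rw [hN, inner_sum, real_inner_smul_right, inner_sum]
  rw [integral_finsetSum _ fun t _ => (integrable_finsetSum _ fun i _ => hint t i).const_mul _]
  refine Finset.sum_eq_zero fun t _ => ?_
  rw [integral_const_mul, integral_finsetSum _ fun i _ => hint t i,
    Finset.sum_eq_zero fun i _ => h.integral_inner_noise (hg t i), mul_zero]

end Noise

end Valid

end Expectation

end Run

namespace Run

section Recursions

variable {Ω S : Type*} [m0 : MeasurableSpace Ω] {d n m b : ℕ}

namespace Valid

variable {R : Run Ω S d n m b} {μ : Measure Ω} {p L s : ℝ}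

/-- Young's inequality with weight `λ / 2` keeps half of the contraction `1 - λ`, at the price of a
factor `3 / λ` on the perturbation. -/
lemma young_coeffs {lam : ℝ} (h0 : 0 < lam) (h1 : lam ≤ 1) :
    (1 - lam) * (1 + lam / 2) ≤ 1 - lam / 2 ∧ 1 + 1 / (lam / 2) ≤ 3 / lam := by
  constructor
  · nlinarith
  · rw [le_div_iff₀ h0]
    have : (1 + 1 / (lam / 2)) * lam = lam + 2 := by field_simp
    linarith

variable [IsProbabilityMeasure μ] (h : R.Valid μ p L s)
include h

/-! ### Estimates in expectation for one round -/

lemma integral_drift_le (hκ : (L * R.ηl * R.τ) ^ 2 ≤ 1 / 8) (k : ℕ) :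
    L ^ 2 * ∫ ω, R.drift k ω ∂μ ≤ 8 * (L * R.ηl * R.τ) ^ 2 * R.τ
      * (∫ ω, R.trackingErr k ω ∂μ + 3 * (n * ∫ ω, R.gradSq k ω ∂μ)
        + 3 * (L ^ 2 * ∫ ω, R.consensusErr k ω ∂μ) + 5 * (n * s)) := by
  have hx : Integrable (fun ω => R.consensusErr k ω) μ :=
    (h.finiteMeasurable_consensusErr k).integrable
  have hy : Integrable (fun ω => R.trackingErr k ω) μ :=
    (h.finiteMeasurable_trackingErr k).integrable
  have hg : Integrable (fun ω => R.gradSq k ω) μ := (h.finiteMeasurable_gradSq k).integrable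
  have hd : Integrable (fun ω => R.drift k ω) μ := (h.finiteMeasurable_drift k).integrable
  have hN : Integrable (fun ω => R.noiseSq k ω) μ := h.integrable_noiseSq k
  have h0 := h.integrable_frobSq_noise k 0
  have key := integral_mono (μ := μ) (f := fun ω => L ^ 2 * R.drift k ω)
    (g := fun ω => 8 * (L * R.ηl * R.τ) ^ 2 * (R.τ * (R.trackingErr k ω
      + 3 * (n * R.gradSq k ω + L ^ 2 * R.consensusErr k ω + frobSq (R.noise k 0 ω)))
      + R.noiseSq k ω)) (by fun_prop) (by fun_prop) fun ω => by
        refine (drift_le h.smooth hκ k ω).trans (mul_le_mul_of_nonneg_left ?_ (by positivity))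
        have hY := mul_le_mul_of_nonneg_left
          (frobSq_Y_zero_le h.n_pos h.mixing h.smooth k ω) (Nat.cast_nonneg (α := ℝ) R.τ)
        linarith
  simp (disch := fun_prop) only [integral_const_mul, integral_add] at key
  refine key.trans ?_
  rw [mul_assoc (8 * (L * R.ηl * R.τ) ^ 2) (R.τ : ℝ)]
  refine mul_le_mul_of_nonneg_left ?_ (by positivity)
  have h1 := h.integral_noiseSq_le k
  have h2 := mul_le_mul_of_nonneg_left (h.integral_frobSq_noise_le k 0)
    (Nat.cast_nonneg (α := ℝ) R.τ)
  linarith only [h1, h2]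

lemma integral_f_round_le (hη : 0 ≤ R.η) (hβ : 4 * (L * R.η * R.τ) ≤ 1) (k : ℕ) :
    ∫ ω, R.f (avg (R.X (k + 1) 0 ω)) ∂μ ≤ ∫ ω, R.f (avg (R.X k 0 ω)) ∂μ
      - R.η * R.τ / 2 * ∫ ω, R.gradSq k ω ∂μ
      + R.η * L ^ 2 / n * (R.τ * ∫ ω, R.consensusErr k ω ∂μ + ∫ ω, R.drift k ω ∂μ)
      + 2 * L * R.η ^ 2 * (R.τ * s / n) := by
  have hx : Integrable (fun ω => R.consensusErr k ω) μ :=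
    (h.finiteMeasurable_consensusErr k).integrable
  have hg : Integrable (fun ω => R.gradSq k ω) μ := (h.finiteMeasurable_gradSq k).integrable
  have hd : Integrable (fun ω => R.drift k ω) μ := (h.finiteMeasurable_drift k).integrable
  have hN := h.integrable_norm_avgNoise_sq k
  have hf : ∀ k, Integrable (fun ω => R.f (avg (R.X k 0 ω))) μ := fun k =>
    ((h.finiteMeasurable_traj k 0).comp fun q => R.f (avg q.X)).integrable
  have hf0 := hf k
  have hi : Integrable (fun ω => inner ℝ (gradient (globalLoss R.loss R.D) (avg (R.X k 0 ω)))
      (R.avgNoise k ω)) μ :=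
    (((h.finiteMeasurable_traj k 0).prodMk (h.finiteMeasurable_avgNoise k)).comp
      fun q => inner ℝ (gradient (globalLoss R.loss R.D) (avg q.1.X)) q.2).integrable
  have key := integral_mono (hf (k + 1)) (by fun_prop)
    fun ω => f_round_le h.n_pos h.mixing h.L_pos.le h.smooth hη hβ k ω
  simp (disch := fun_prop) only [integral_const_mul, integral_add, integral_sub,
    h.integral_inner_gradient_avgNoise k] at key
  have h1 := mul_le_mul_of_nonneg_left (h.integral_norm_avgNoise_sq_le k)
    (mul_nonneg (mul_nonneg two_pos.le h.L_pos.le) (sq_nonneg R.η))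
  linarith only [key, h1]

lemma integral_frobSq_X_round_sub_le (k : ℕ) :
    ∫ ω, frobSq (R.X (k + 1) 0 ω - R.X k 0 ω) ∂μ
      ≤ 2 * ∫ ω, R.consensusErr (k + 1) ω ∂μ + 2 * ∫ ω, R.consensusErr k ω ∂μ
        + R.η ^ 2 * (2 * (R.τ * s) + 4 * R.τ ^ 2 * (n * ∫ ω, R.gradSq k ω ∂μ)
          + 8 * R.τ * L ^ 2 * (R.τ * ∫ ω, R.consensusErr k ω ∂μ + ∫ ω, R.drift k ω ∂μ)) := by
  have hx : ∀ k, Integrable (fun ω => R.consensusErr k ω) μ := fun k =>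
    (h.finiteMeasurable_consensusErr k).integrable
  have hx0 := hx k
  have hx1 := hx (k + 1)
  have hg : Integrable (fun ω => R.gradSq k ω) μ := (h.finiteMeasurable_gradSq k).integrable
  have hd : Integrable (fun ω => R.drift k ω) μ := (h.finiteMeasurable_drift k).integrable
  have hN := h.integrable_norm_avgNoise_sq k
  have hl : Integrable (fun ω => frobSq (R.X (k + 1) 0 ω - R.X k 0 ω)) μ :=
    (((h.finiteMeasurable_traj (k + 1) 0).prodMk (h.finiteMeasurable_traj k 0)).comp
      fun q => frobSq (q.1.X - q.2.X)).integrable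
  have key := integral_mono hl (by fun_prop)
    fun ω => frobSq_X_round_sub_le h.n_pos h.mixing h.smooth k ω
  simp (disch := fun_prop) only [integral_const_mul, integral_add] at key
  have hn : (0 : ℝ) < n := by exact_mod_cast h.n_pos
  have h1 := mul_le_mul_of_nonneg_left (h.integral_norm_avgNoise_sq_le k) hn.le
  rw [mul_div_cancel₀ _ hn.ne'] at h1
  have h2 := mul_le_mul_of_nonneg_left h1 (sq_nonneg R.η)
  linarith only [key, h2]

/-- One random mixing contracts, in expectation, the disagreement of a matrix that is determined
before the choice of the mixing matrix, by the factor `1 - λ_p`. -/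
lemma integral_frobSq_disagreement_mix_le {k : ℕ} {A : Ω → Cols d n}
    (hA : FiniteMeasurable (R.info {Sum.inl k}ᶜ) A) :
    ∫ ω, frobSq (disagreement (mix (A ω) (R.mixer k ω))) ∂μ
      ≤ (1 - expectedMixingRate R.W p) * ∫ ω, frobSq (disagreement (A ω)) ∂μ := by
  have hfr := h.integral_gossip_mul (hA.comp fun a => frobSq (disagreement (mix a R.W)))
  have h1 : ∀ ω, frobSq (disagreement (mix (A ω) (R.mixer k ω)))
      = (if R.server k ω then 0 else 1) * frobSq (disagreement (mix (A ω) R.W)) := by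
    intro ω
    by_cases hs : R.server k ω = true
    · simp only [mixer, hs, if_true, disagreement_mix_avgMatrix h.n_pos]
      simp [frobSq]
    · simp [mixer, hs]
  simp_rw [h1]
  rw [hfr, one_sub_expectedMixingRate, mul_assoc]
  refine mul_le_mul_of_nonneg_left ?_ (sub_nonneg.2 h.p_le_one)
  rw [← integral_const_mul]
  exact integral_mono ((hA.mono (h.info_le _)).comp
    fun a => frobSq (disagreement (mix a R.W))).integrable
    (((hA.mono (h.info_le _)).comp fun a => frobSq (disagreement a)).integrable.const_mul _)
    fun ω => frobSq_disagreement_mix_le h.n_pos h.mixing _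

lemma integral_consensusErr_succ_le (hlam : 0 < expectedMixingRate R.W p) (k : ℕ) :
    ∫ ω, R.consensusErr (k + 1) ω ∂μ
      ≤ (1 - expectedMixingRate R.W p / 2) * ∫ ω, R.consensusErr k ω ∂μ
        + (1 - p) * (3 / expectedMixingRate R.W p) * (R.η ^ 2 * (4 * R.τ
          * (R.τ * ∫ ω, R.trackingErr k ω ∂μ + L ^ 2 * ∫ ω, R.drift k ω ∂μ
            + 2 * R.τ * (n * s)))) := by
  set lam := expectedMixingRate R.W p with hlamdef
  have hlam1 : lam ≤ 1 := h.expectedMixingRate_le_one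
  have hlamp : 1 - lam ≤ 1 - p := h.one_sub_expectedMixingRate_le
  obtain ⟨hy1, hy2⟩ := young_coeffs hlam hlam1
  have hx : Integrable (fun ω => R.consensusErr k ω) μ :=
    (h.finiteMeasurable_consensusErr k).integrable
  have hy : Integrable (fun ω => R.trackingErr k ω) μ :=
    (h.finiteMeasurable_trackingErr k).integrable
  have hd : Integrable (fun ω => R.drift k ω) μ := (h.finiteMeasurable_drift k).integrable
  have hN : Integrable (fun ω => R.noiseSq k ω) μ := h.integrable_noiseSq k
  have hsum : ∀ t, FiniteMeasurable (R.info {Sum.inl k}ᶜ) (R.traj k t) := fun t =>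
    (Run.finiteMeasurable_traj k t).mono (info_mono (R := R) past_subset_compl_inl)
  have hA : FiniteMeasurable (R.info {Sum.inl k}ᶜ)
      (fun ω => R.X k 0 ω - R.η • ∑ t ∈ Finset.range R.τ, R.Y k t ω) :=
    ((hsum 0).prodMk (FiniteMeasurable.sum (Finset.range R.τ)
      fun t => (hsum t).comp fun q => q.Y)).comp fun q => q.1.X - R.η • q.2
  have h1 := h.integral_frobSq_disagreement_mix_le hA
  simp_rw [← R.X_round] at h1
  have h2 := integral_mono (μ := μ)
    (g := fun ω => (1 + lam / 2) * R.consensusErr k ω + 3 / lam * (R.η ^ 2 * (4 * R.τ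
      * (R.τ * R.trackingErr k ω + L ^ 2 * R.drift k ω + R.noiseSq k ω))))
    ((hA.mono (h.info_le _)).comp fun a => frobSq (disagreement a)).integrable
    (by fun_prop) fun ω => by
      have hpos : 0 ≤ R.η ^ 2
          * frobSq (disagreement (∑ t ∈ Finset.range R.τ, R.Y k t ω)) :=
        mul_nonneg (sq_nonneg _) (frobSq_nonneg _)
      have ha := frobSq_add_le (disagreement (R.X k 0 ω))
        (-(R.η • disagreement (∑ t ∈ Finset.range R.τ, R.Y k t ω))) (half_pos hlam)
      rw [frobSq_neg, frobSq_smul, ← sub_eq_add_neg, ← disagreement_smul,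
        ← disagreement_sub] at ha
      refine ha.trans (add_le_add le_rfl ?_)
      refine (mul_le_mul_of_nonneg_right hy2 hpos).trans ?_
      exact mul_le_mul_of_nonneg_left (mul_le_mul_of_nonneg_left
        (frobSq_disagreement_sum_Y_le h.n_pos h.smooth k ω) (sq_nonneg _)) (by positivity)
  simp (disch := fun_prop) only [integral_const_mul, integral_add] at h2
  have h3 := h.integral_noiseSq_le k
  set EX := ∫ ω, R.consensusErr k ω ∂μ
  set EY := ∫ ω, R.trackingErr k ω ∂μ
  set ED := ∫ ω, R.drift k ω ∂μ
  set EN := ∫ ω, R.noiseSq k ω ∂μ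
  have hEX : 0 ≤ EX := integral_nonneg fun ω => consensusErr_nonneg k ω
  have hEY : 0 ≤ EY := integral_nonneg fun ω => trackingErr_nonneg k ω
  have hED : 0 ≤ ED := integral_nonneg fun ω => drift_nonneg k ω
  have hEN : 0 ≤ EN := integral_nonneg fun ω => add_nonneg
    (Finset.sum_nonneg fun _ _ => frobSq_nonneg _)
    (mul_nonneg (Nat.cast_nonneg _) (frobSq_nonneg _))
  have h4 : 0 ≤ 3 / lam * (R.η ^ 2 * (4 * R.τ * (R.τ * EY + L ^ 2 * ED + EN))) := by positivity
  calc ∫ ω, R.consensusErr (k + 1) ω ∂μ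
      ≤ (1 - lam) * ((1 + lam / 2) * EX
          + 3 / lam * (R.η ^ 2 * (4 * R.τ * (R.τ * EY + L ^ 2 * ED + EN)))) :=
        h1.trans (mul_le_mul_of_nonneg_left h2 (sub_nonneg.2 hlam1))
    _ = (1 - lam) * (1 + lam / 2) * EX + (1 - lam)
          * (3 / lam * (R.η ^ 2 * (4 * R.τ * (R.τ * EY + L ^ 2 * ED + EN)))) := by ring
    _ ≤ (1 - lam / 2) * EX + (1 - p)
          * (3 / lam * (R.η ^ 2 * (4 * R.τ * (R.τ * EY + L ^ 2 * ED + EN)))) :=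
        add_le_add (mul_le_mul_of_nonneg_right hy1 hEX) (mul_le_mul_of_nonneg_right hlamp h4)
    _ ≤ (1 - lam / 2) * EX + (1 - p)
          * (3 / lam * (R.η ^ 2 * (4 * R.τ * (R.τ * EY + L ^ 2 * ED + 2 * R.τ * (n * s))))) := by
        have := sub_nonneg.2 h.p_le_one
        gcongr
    _ = _ := by ring

lemma integral_trackingErr_succ_le (hlam : 0 < expectedMixingRate R.W p) (k : ℕ) :
    ∫ ω, R.trackingErr (k + 1) ω ∂μ
      ≤ (1 - expectedMixingRate R.W p / 2) * ∫ ω, R.trackingErr k ω ∂μ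
        + 3 / expectedMixingRate R.W p
          * (3 * (L ^ 2 * ∫ ω, frobSq (R.X (k + 1) 0 ω - R.X k 0 ω) ∂μ)
            + 6 * ((1 - p) * (n * s))) := by
  set lam := expectedMixingRate R.W p with hlamdef
  have hlam1 : lam ≤ 1 := h.expectedMixingRate_le_one
  obtain ⟨hy1, hy2⟩ := young_coeffs hlam hlam1
  let gossip : Ω → ℝ := fun ω => if R.server k ω then 0 else 1
  have hgossip0 : ∀ ω, 0 ≤ gossip ω := fun ω => by
    by_cases hs : R.server k ω = true <;> simp [gossip, hs]
  have hgossip1 : ∀ ω, gossip ω ≤ 1 := fun ω => by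
    by_cases hs : R.server k ω = true <;> simp [gossip, hs]
  have hs1 : ∀ {T}, Sum.inl k ∈ T → FiniteMeasurable (R.info T) gossip := fun hT =>
    (finiteMeasurable_server (R := R) hT).comp fun c => if c then (0 : ℝ) else 1
  have hsm : FiniteMeasurable m0 gossip := (hs1 (Set.mem_singleton _)).mono (h.info_le _)
  have hY0 : FiniteMeasurable (R.info {Sum.inl k}ᶜ) (R.Y k 0) :=
    ((Run.finiteMeasurable_traj k 0).mono (info_mono (R := R) past_subset_compl_inl)).comp
      fun q => q.Y
  have h1 := h.integral_frobSq_disagreement_mix_le hY0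
  -- The noise enters the disagreement of the trackers only in rounds without the server.
  have hnext : ∀ i, ∫ ω, gossip ω * ‖R.noise (k + 1) 0 ω i‖ ^ 2 ∂μ ≤ s * (1 - p) := fun i => by
    refine (h.integral_mul_noise_sq_le (hs1 ?_) hgossip0).trans_eq ?_
    · simp
    · rw [h.integral_gossip]
  have hcur : ∀ i, ∫ ω, gossip ω * ‖R.noise k 0 ω i‖ ^ 2 ∂μ ≤ s * (1 - p) := fun i => by
    have hu : FiniteMeasurable (R.info {Sum.inl k}ᶜ) (fun ω => ‖R.noise k 0 ω i‖ ^ 2) :=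
      (finiteMeasurable_noise_apply (R := R) past_subset_compl_inl (by simp)).comp
        fun v => ‖v‖ ^ 2
    rw [h.integral_gossip_mul hu, mul_comm]
    exact mul_le_mul_of_nonneg_right (h.integral_noise_sq_le k 0 i) (sub_nonneg.2 h.p_le_one)
  have hintn : ∀ j i, Integrable (fun ω => gossip ω * ‖R.noise j 0 ω i‖ ^ 2) μ := fun j i =>
    ((hsm.prodMk (h.finiteMeasurable_noise j 0)).comp fun q => q.1 * ‖q.2 i‖ ^ 2).integrable
  have hsumn : ∀ j, (∀ i, ∫ ω, gossip ω * ‖R.noise j 0 ω i‖ ^ 2 ∂μ ≤ s * (1 - p)) →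
      ∫ ω, gossip ω * frobSq (R.noise j 0 ω) ∂μ ≤ (1 - p) * (n * s) := by
    intro j hj
    simp only [frobSq, Finset.mul_sum]
    rw [integral_finsetSum _ fun i _ => hintn j i]
    refine (Finset.sum_le_sum fun i _ => hj i).trans (le_of_eq ?_)
    simp; ring
  have hintf : ∀ j, Integrable (fun ω => gossip ω * frobSq (R.noise j 0 ω)) μ := fun j =>
    ((hsm.prodMk (h.finiteMeasurable_noise j 0)).comp fun q => q.1 * frobSq q.2).integrable
  have hintf0 := hintf k
  have hintf1 := hintf (k + 1)
  have hintX : Integrable (fun ω => frobSq (R.X (k + 1) 0 ω - R.X k 0 ω)) μ :=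
    (((h.finiteMeasurable_traj (k + 1) 0).prodMk (h.finiteMeasurable_traj k 0)).comp
      fun q => frobSq (q.1.X - q.2.X)).integrable
  have hintY : Integrable
      (fun ω => frobSq (disagreement (mix (R.Y k 0 ω) (R.mixer k ω)))) μ :=
    (((h.finiteMeasurable_traj k 0).prodMk ((finiteMeasurable_server (R := R)
      (Set.mem_singleton (Sum.inl k))).mono (h.info_le _))).comp
      fun q => frobSq (disagreement (mix q.1.Y (if q.2 then avgMatrix n else R.W)))).integrable
  have h2 := integral_mono (μ := μ)
    (g := fun ω => (1 + lam / 2) * frobSq (disagreement (mix (R.Y k 0 ω) (R.mixer k ω)))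
      + 3 / lam * (3 * (L ^ 2 * frobSq (R.X (k + 1) 0 ω - R.X k 0 ω)
        + gossip ω * frobSq (R.noise (k + 1) 0 ω) + gossip ω * frobSq (R.noise k 0 ω))))
    (h.finiteMeasurable_trackingErr (k + 1)).integrable (by fun_prop) fun ω => by
      let B : Cols d n := (R.H (k + 1) 0 ω - R.H k 0 ω)
        + (R.noise (k + 1) 0 ω - R.noise k 0 ω)
      have hB : frobSq B ≤ 3 * (L ^ 2 * frobSq (R.X (k + 1) 0 ω - R.X k 0 ω)
          + frobSq (R.noise (k + 1) 0 ω) + frobSq (R.noise k 0 ω)) := by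
        refine (frobSq_add_sub_le _ _ _).trans ?_
        have := frobSq_localGrads_sub_le h.smooth (R.X (k + 1) 0 ω) (R.X k 0 ω)
        unfold H
        linarith
      have hmix : frobSq (disagreement (mix B (R.mixer k ω))) ≤ gossip ω * frobSq B := by
        by_cases hs : R.server k ω = true
        · simp only [mixer, hs, if_true, disagreement_mix_avgMatrix h.n_pos, gossip]
          simp [frobSq]
        · simpa [mixer, hs, gossip] using
            frobSq_disagreement_mix_le_frobSq h.n_pos h.mixing B
      have hmix' : frobSq (disagreement (mix B (R.mixer k ω)))
          ≤ 3 * (L ^ 2 * frobSq (R.X (k + 1) 0 ω - R.X k 0 ω)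
        + gossip ω * frobSq (R.noise (k + 1) 0 ω) + gossip ω * frobSq (R.noise k 0 ω)) := by
        have ha := mul_le_mul_of_nonneg_left hB (hgossip0 ω)
        have hb := mul_le_mul_of_nonneg_right (hgossip1 ω)
          (mul_nonneg (sq_nonneg L) (frobSq_nonneg (R.X (k + 1) 0 ω - R.X k 0 ω)))
        linarith only [hmix, ha, hb]
      have ha := frobSq_add_le (disagreement (mix (R.Y k 0 ω) (R.mixer k ω)))
        (disagreement (mix B (R.mixer k ω))) (half_pos hlam)
      rw [← disagreement_add, ← mix_add, ← R.Y_round] at ha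
      refine ha.trans (add_le_add le_rfl ?_)
      exact mul_le_mul hy2 hmix' (frobSq_nonneg _) (by positivity)
  simp (disch := fun_prop) only [integral_const_mul, integral_add] at h2
  have h3 := hsumn k hcur
  have h4 := hsumn (k + 1) hnext
  have hEY : 0 ≤ ∫ ω, R.trackingErr k ω ∂μ := integral_nonneg fun ω => trackingErr_nonneg k ω
  refine h2.trans (add_le_add ?_ (mul_le_mul_of_nonneg_left ?_ (by positivity)))
  · calc (1 + lam / 2) * ∫ ω, frobSq (disagreement (mix (R.Y k 0 ω) (R.mixer k ω))) ∂μ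
        ≤ (1 + lam / 2) * ((1 - lam) * ∫ ω, R.trackingErr k ω ∂μ) :=
          mul_le_mul_of_nonneg_left h1 (by positivity)
      _ = (1 - lam) * (1 + lam / 2) * ∫ ω, R.trackingErr k ω ∂μ := by ring
      _ ≤ _ := mul_le_mul_of_nonneg_right hy1 hEY
  · linarith only [h3, h4]

end Valid

end Recursions

end Run

/-! ### Summation over the rounds -/

/-- Summing a perturbed linear recursion with contraction factor `1 - λ / 2`. -/
lemma sum_le_of_contraction {z u : ℕ → ℝ} {lam : ℝ} (h0 : 0 < lam) (hz : ∀ k, 0 ≤ z k)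
    (hrec : ∀ k, z (k + 1) ≤ (1 - lam / 2) * z k + u k) (K : ℕ) :
    ∑ k ∈ Finset.range K, z k ≤ 2 / lam * (z 0 + ∑ k ∈ Finset.range K, u k) := by
  have h1 : ∑ k ∈ Finset.range K, z (k + 1)
      ≤ (1 - lam / 2) * ∑ k ∈ Finset.range K, z k + ∑ k ∈ Finset.range K, u k := by
    rw [Finset.mul_sum, ← Finset.sum_add_distrib]
    exact Finset.sum_le_sum fun k _ => hrec k
  have h2 : ∑ k ∈ Finset.range K, z (k + 1) = ∑ k ∈ Finset.range K, z k + z K - z 0 := by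
    rw [← Finset.sum_range_succ, Finset.sum_range_succ']; ring
  have h3 := hz K
  rw [div_mul_eq_mul_div, le_div_iff₀ h0]
  linarith

lemma sum_succ_le_of_contraction {z u : ℕ → ℝ} {lam : ℝ} (h0 : 0 < lam) (h1 : lam ≤ 1)
    (hz : ∀ k, 0 ≤ z k) (hz0 : z 0 = 0) (hrec : ∀ k, z (k + 1) ≤ (1 - lam / 2) * z k + u k)
    (K : ℕ) :
    ∑ k ∈ Finset.range K, z (k + 1) ≤ 2 / lam * ∑ k ∈ Finset.range K, u k := by
  have h2 := sum_le_of_contraction h0 hz hrec K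
  rw [hz0, zero_add] at h2
  have h3 : ∑ k ∈ Finset.range K, z (k + 1)
      ≤ (1 - lam / 2) * ∑ k ∈ Finset.range K, z k + ∑ k ∈ Finset.range K, u k := by
    rw [Finset.mul_sum, ← Finset.sum_add_distrib]
    exact Finset.sum_le_sum fun k _ => hrec k
  have h4 : (1 - lam / 2) * ∑ k ∈ Finset.range K, z k
      ≤ (1 - lam / 2) * (2 / lam * ∑ k ∈ Finset.range K, u k) :=
    mul_le_mul_of_nonneg_left h2 (by linarith)
  have h5 : (1 - lam / 2) * (2 / lam * ∑ k ∈ Finset.range K, u k) + ∑ k ∈ Finset.range K, u k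
      = 2 / lam * ∑ k ∈ Finset.range K, u k := by field_simp; ring
  linarith

/-- Solution of the coupled inequalities between the accumulated errors: `x` and `x'` are the
consensus errors, `D` the drift, `Y` the disagreement of the trackers, `z` the squared global
steps and `G` the squared gradients, all suitably scaled. The step size condition
`β ≤ λ² / 180` makes every loop gain small. -/
lemma gradient_le_of_coupled {x x' D Y z G F y0 M N q lam β κ : ℝ}
    (hx0 : 0 ≤ x) (hD0 : 0 ≤ D) (hY0 : 0 ≤ Y) (hz0 : 0 ≤ z) (hG0 : 0 ≤ G)
    (hF0 : 0 ≤ F) (hy0 : 0 ≤ y0) (hM0 : 0 ≤ M) (hN0 : 0 ≤ N) (hq0 : 0 ≤ q) (hq1 : q ≤ 1)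
    (hlam0 : 0 < lam) (hlam1 : lam ≤ 1) (hβ0 : 0 ≤ β) (hβ : β ≤ lam ^ 2 / 180)
    (hκ : κ ^ 2 ≤ β ^ 2 / lam ^ 2)
    (hD : D ≤ 8 * κ ^ 2 * (Y + 3 * G + 3 * x + 5 * N))
    (hG : G ≤ 2 * F + 2 * (x + D) + 4 * M)
    (hx : x ≤ 24 * q * β ^ 2 / lam ^ 2 * (Y + D + 2 * N))
    (hx' : x' ≤ 24 * q * β ^ 2 / lam ^ 2 * (Y + D + 2 * N))
    (hY : Y ≤ 2 / lam * (y0 + 3 / lam * (3 * z + 6 * (q * N))))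
    (hz : z ≤ 2 * x' + 2 * x + 2 * β * M + β ^ 2 * (4 * G + 8 * x + 8 * D)) :
    G ≤ 5000 * (F + M + κ ^ 2 * N + β ^ 2 / lam ^ 4 * (q * N) + y0) := by
  -- `B = (β / λ²)²` is the square of the effective gain and `w` is the scaled tracking error.
  obtain ⟨B, hB⟩ : ∃ B, B = β ^ 2 / lam ^ 4 := ⟨_, rfl⟩
  obtain ⟨w, hw⟩ : ∃ w, w = B * (lam ^ 2 * Y) := ⟨_, rfl⟩
  have hβB : β ^ 2 = lam ^ 4 * B := by rw [hB]; field_simp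
  have hβB2 : β ^ 2 / lam ^ 2 = lam ^ 2 * B := by rw [hβB]; field_simp
  have hB0 : 0 ≤ B := by rw [hB]; positivity
  have hB1 : B ≤ 1 / 32400 := by
    rw [hB, div_le_iff₀ (by positivity)]
    have := pow_le_pow_left₀ hβ0 hβ 2
    linarith [show (lam ^ 2 / 180) ^ 2 = 1 / 32400 * lam ^ 4 by ring]
  have hlam2 : lam ^ 2 ≤ 1 := pow_le_one₀ hlam0.le hlam1
  have hlam4 : lam ^ 4 ≤ 1 := pow_le_one₀ hlam0.le hlam1
  have hlam2' : 0 ≤ lam ^ 2 := sq_nonneg _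
  have hw0 : 0 ≤ w := by rw [hw]; positivity
  have hD1 : D ≤ 8 * w + 24 / 32400 * (G + x) + 40 * (κ ^ 2 * N) := by
    have h1 : κ ^ 2 * (Y + 3 * (G + x)) ≤ lam ^ 2 * B * (Y + 3 * (G + x)) :=
      mul_le_mul_of_nonneg_right (hκ.trans_eq hβB2) (by positivity)
    have h2 : lam ^ 2 * (B * (3 * (G + x))) ≤ 1 * (1 / 32400 * (3 * (G + x))) :=
      mul_le_mul hlam2 (mul_le_mul_of_nonneg_right hB1 (by positivity)) (by positivity)
        zero_le_one
    rw [hw]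
    linarith
  have hbound : 24 * q * β ^ 2 / lam ^ 2 * (Y + D + 2 * N)
      ≤ 24 * w + 24 / 32400 * D + 48 * (B * (q * N)) := by
    have h0 : 24 * q * β ^ 2 / lam ^ 2 * (Y + D + 2 * N)
        = 24 * (q * w) + 24 * (q * (lam ^ 2 * (B * D))) + 48 * (lam ^ 2 * (B * (q * N))) := by
      rw [mul_div_assoc, hβB2, hw]; ring
    have h1 : q * w ≤ 1 * w := mul_le_mul_of_nonneg_right hq1 hw0
    have h2 : q * (lam ^ 2 * (B * D)) ≤ 1 * (1 * (1 / 32400 * D)) :=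
      mul_le_mul hq1 (mul_le_mul hlam2 (mul_le_mul_of_nonneg_right hB1 hD0) (by positivity)
        zero_le_one) (by positivity) zero_le_one
    have h3 : lam ^ 2 * (B * (q * N)) ≤ 1 * (B * (q * N)) :=
      mul_le_mul_of_nonneg_right hlam2 (by positivity)
    linarith
  have hw1 : w ≤ 2 * y0 + 18 / 32400 * z + 36 * (B * (q * N)) := by
    have h1 := mul_le_mul_of_nonneg_left hY (mul_nonneg hB0 hlam2')
    have h2 : B * lam ^ 2 * (2 / lam * (y0 + 3 / lam * (3 * z + 6 * (q * N))))
        = 2 * (B * (lam * y0)) + 18 * (B * z) + 36 * (B * (q * N)) := by field_simp; ring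
    have h3 : B * (lam * y0) ≤ 1 * (1 * y0) :=
      mul_le_mul (by linarith) (mul_le_mul_of_nonneg_right hlam1 hy0) (by positivity) zero_le_one
    have h4 : B * z ≤ 1 / 32400 * z := mul_le_mul_of_nonneg_right hB1 hz0
    rw [hw]
    linarith
  have hz1 : z ≤ 2 * x' + 2 * x + 1 / 90 * M + 1 / 32400 * (4 * G + 8 * x + 8 * D) := by
    have h1 : β * M ≤ 1 / 180 * M := mul_le_mul_of_nonneg_right (by linarith) hM0
    have h2 : β ^ 2 * (4 * G + 8 * x + 8 * D) ≤ 1 / 32400 * (4 * G + 8 * x + 8 * D) := by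
      refine mul_le_mul_of_nonneg_right ?_ (by positivity)
      rw [hβB]
      calc lam ^ 4 * B ≤ 1 * (1 / 32400) := mul_le_mul hlam4 hB1 hB0 zero_le_one
        _ = _ := one_mul _
    linarith
  have hx1 := hx.trans hbound
  have hx1' := hx'.trans hbound
  rw [← hB]
  have hQ : 0 ≤ B * (q * N) := by positivity
  have hKN : 0 ≤ κ ^ 2 * N := by positivity
  clear hD hx hx' hY hz hw hβB hβB2 hbound
  linarith

namespace Run

variable {Ω S : Type*} [m0 : MeasurableSpace Ω] {d n m b : ℕ}

/-! ### The convergence rate -/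

/-- The accumulated squared gradients in terms of the gains `β = L η τ` and `κ = L η_l τ`. -/
lemma Valid.sum_gradSq_le {R : Run Ω S d n m b} {μ : Measure Ω} [IsProbabilityMeasure μ]
    {p L s lam : ℝ} (h : R.Valid μ p L s) (hs : 0 ≤ s) (hlam : lam = expectedMixingRate R.W p)
    (hlam0 : 0 < lam) (hbdd : BddBelow (Set.range R.f)) (hη : 0 < R.η)
    (hβ : L * R.η * R.τ ≤ lam ^ 2 / 180)
    (hκ : (L * R.ηl * R.τ) ^ 2 ≤ (L * R.η * R.τ) ^ 2 / lam ^ 2)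
    (hκ8 : (L * R.ηl * R.τ) ^ 2 ≤ 1 / 8) (K : ℕ) :
    n * ∑ k ∈ Finset.range K, ∫ ω, R.gradSq k ω ∂μ
      ≤ 5000 * (n * (R.f R.x0 - ⨅ x, R.f x) / (R.η * R.τ) + L * R.η * (K * s)
        + (L * R.ηl * R.τ) ^ 2 * (K * (n * s))
        + (L * R.η * R.τ) ^ 2 / lam ^ 4 * ((1 - p) * (K * (n * s)))
        + ∫ ω, R.trackingErr 0 ω ∂μ) := by
  have hn : (0 : ℝ) < n := by exact_mod_cast h.n_pos
  have hL := h.L_pos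
  have hτ : (0 : ℝ) < R.τ := by unfold τ; positivity
  have hlam1 : lam ≤ 1 := hlam ▸ h.expectedMixingRate_le_one
  have hlam2 : lam ^ 2 ≤ 1 := pow_le_one₀ hlam0.le hlam1
  have hp0 : 0 ≤ 1 - p := sub_nonneg.2 h.p_le_one
  have hβ4 : 4 * (L * R.η * R.τ) ≤ 1 := by linarith
  let EX : ℕ → ℝ := fun k => ∫ ω, R.consensusErr k ω ∂μ
  let EY : ℕ → ℝ := fun k => ∫ ω, R.trackingErr k ω ∂μ
  let EG : ℕ → ℝ := fun k => ∫ ω, R.gradSq k ω ∂μ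
  let ED : ℕ → ℝ := fun k => ∫ ω, R.drift k ω ∂μ
  let EZ : ℕ → ℝ := fun k => ∫ ω, frobSq (R.X (k + 1) 0 ω - R.X k 0 ω) ∂μ
  let Ef : ℕ → ℝ := fun k => ∫ ω, R.f (avg (R.X k 0 ω)) ∂μ
  have hEX : ∀ k, 0 ≤ EX k := fun k => integral_nonneg fun ω => consensusErr_nonneg k ω
  have hEY : ∀ k, 0 ≤ EY k := fun k => integral_nonneg fun ω => trackingErr_nonneg k ω
  have hEG : ∀ k, 0 ≤ EG k := fun k => integral_nonneg fun ω => gradSq_nonneg k ω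
  have hED : ∀ k, 0 ≤ ED k := fun k => integral_nonneg fun ω => drift_nonneg k ω
  have hEZ : ∀ k, 0 ≤ EZ k := fun k => integral_nonneg fun ω => frobSq_nonneg _
  have hEX0 : EX 0 = 0 := by simp [EX, consensusErr_zero h.n_pos]
  -- The objective: the descent inequalities telescope.
  have hf0 : Ef 0 = R.f R.x0 := by
    have : ∀ ω, R.X 0 0 ω = fun _ => R.x0 := fun ω => rfl
    simp [Ef, this, avg_const h.n_pos]
  have hfK : ⨅ x, R.f x ≤ Ef K := by
    have hint : Integrable (fun ω => R.f (avg (R.X K 0 ω))) μ :=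
      ((h.finiteMeasurable_traj K 0).comp fun q => R.f (avg q.X)).integrable
    have := integral_mono (integrable_const (μ := μ) (⨅ x, R.f x)) hint
      fun ω => ciInf_le hbdd _
    simpa using this
  have hF0 : 0 ≤ R.f R.x0 - ⨅ x, R.f x := sub_nonneg.2 (ciInf_le hbdd _)
  have hdesc : ∀ k, Ef (k + 1) ≤ Ef k - R.η * R.τ / 2 * EG k
      + R.η * L ^ 2 / n * (R.τ * EX k + ED k) + 2 * L * R.η ^ 2 * (R.τ * s / n) :=
    fun k => h.integral_f_round_le hη.le hβ4 k
  have hsum : R.η * R.τ / 2 * ∑ k ∈ Finset.range K, EG k ≤ (R.f R.x0 - ⨅ x, R.f x)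
      + R.η * L ^ 2 / n * (R.τ * ∑ k ∈ Finset.range K, EX k + ∑ k ∈ Finset.range K, ED k)
      + K * (2 * L * R.η ^ 2 * (R.τ * s / n)) := by
    have h1 := Finset.sum_le_sum fun k (_ : k ∈ Finset.range K) => hdesc k
    simp only [Finset.sum_add_distrib, Finset.sum_sub_distrib, ← Finset.mul_sum,
      Finset.sum_const, Finset.card_range, nsmul_eq_mul] at h1
    have h2 := Finset.sum_range_succ' Ef K
    rw [Finset.sum_range_succ] at h2
    linarith
  -- The recursions for the errors.
  have hX : ∀ T, (T ≤ 2 / lam * ∑ k ∈ Finset.range K, (1 - p) * (3 / lam) * (R.η ^ 2 * (4 * R.τ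
          * (R.τ * EY k + L ^ 2 * ED k + 2 * R.τ * (n * s))))) →
      L ^ 2 * T ≤ 24 * (1 - p) * (L * R.η * R.τ) ^ 2 / lam ^ 2 * (∑ k ∈ Finset.range K, EY k
        + L ^ 2 * (∑ k ∈ Finset.range K, ED k) / R.τ + 2 * (K * (n * s))) := by
    intro T hT
    refine (mul_le_mul_of_nonneg_left hT (sq_nonneg L)).trans_eq ?_
    simp only [Finset.sum_add_distrib, ← Finset.mul_sum, Finset.sum_const, Finset.card_range,
      nsmul_eq_mul]
    field_simp
    ring
  have hrecX : ∀ k, EX (k + 1) ≤ (1 - lam / 2) * EX k + (1 - p) * (3 / lam) * (R.η ^ 2 * (4 * R.τ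
          * (R.τ * EY k + L ^ 2 * ED k + 2 * R.τ * (n * s)))) := fun k => by
    have := h.integral_consensusErr_succ_le (hlam ▸ hlam0) k
    rwa [← hlam] at this
  have hrecY : ∀ k, EY (k + 1) ≤ (1 - lam / 2) * EY k + 3 / lam
      * (3 * (L ^ 2 * EZ k) + 6 * ((1 - p) * (n * s))) := fun k => by
    have := h.integral_trackingErr_succ_le (hlam ▸ hlam0) k
    rwa [← hlam] at this
  have hX1 := sum_le_of_contraction hlam0 hEX hrecX K
  rw [hEX0, zero_add] at hX1
  have hX2 := sum_succ_le_of_contraction hlam0 hlam1 hEX hEX0 hrecX K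
  have hY := sum_le_of_contraction hlam0 hEY hrecY K
  have hZ : ∑ k ∈ Finset.range K, EZ k ≤ 2 * ∑ k ∈ Finset.range K, EX (k + 1)
      + 2 * ∑ k ∈ Finset.range K, EX k + R.η ^ 2 * (2 * (K * (R.τ * s))
        + 4 * R.τ ^ 2 * (n * ∑ k ∈ Finset.range K, EG k)
        + 8 * R.τ * L ^ 2 * (R.τ * ∑ k ∈ Finset.range K, EX k
          + ∑ k ∈ Finset.range K, ED k)) := by
    refine (Finset.sum_le_sum fun k _ => h.integral_frobSq_X_round_sub_le k).trans_eq ?_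
    simp only [Finset.sum_add_distrib, ← Finset.mul_sum, Finset.sum_const, Finset.card_range,
      nsmul_eq_mul]
    ring
  have hD : L ^ 2 * ∑ k ∈ Finset.range K, ED k ≤ 8 * (L * R.ηl * R.τ) ^ 2 * R.τ
      * (∑ k ∈ Finset.range K, EY k + 3 * (n * ∑ k ∈ Finset.range K, EG k)
        + 3 * (L ^ 2 * ∑ k ∈ Finset.range K, EX k) + 5 * (K * (n * s))) := by
    rw [Finset.mul_sum]
    refine (Finset.sum_le_sum fun k _ => h.integral_drift_le hκ8 k).trans_eq ?_
    simp only [Finset.sum_add_distrib, ← Finset.mul_sum, Finset.sum_const, Finset.card_range,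
      nsmul_eq_mul]
    ring
  have hX1' := hX _ hX1
  have hX2' := hX _ hX2
  have hSX : 0 ≤ ∑ k ∈ Finset.range K, EX k := Finset.sum_nonneg fun k _ => hEX k
  have hSX' : 0 ≤ ∑ k ∈ Finset.range K, EX (k + 1) := Finset.sum_nonneg fun k _ => hEX _
  have hSY : 0 ≤ ∑ k ∈ Finset.range K, EY k := Finset.sum_nonneg fun k _ => hEY k
  have hSG : 0 ≤ ∑ k ∈ Finset.range K, EG k := Finset.sum_nonneg fun k _ => hEG k
  have hSD : 0 ≤ ∑ k ∈ Finset.range K, ED k := Finset.sum_nonneg fun k _ => hED k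
  have hSZ : 0 ≤ ∑ k ∈ Finset.range K, EZ k := Finset.sum_nonneg fun k _ => hEZ k
  simp only [← Finset.mul_sum, Finset.sum_add_distrib, Finset.sum_const, Finset.card_range,
    nsmul_eq_mul] at hY
  change n * ∑ k ∈ Finset.range K, EG k ≤ _
  have hy0 : ∫ ω, R.trackingErr 0 ω ∂μ = EY 0 := rfl
  rw [hy0]
  have hy0' := hEY 0
  clear_value EX EY EG ED EZ Ef
  generalize (∑ k ∈ Finset.range K, EX k) = SX at *
  generalize (∑ k ∈ Finset.range K, EX (k + 1)) = SX' at *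
  generalize (∑ k ∈ Finset.range K, EY k) = SY at *
  generalize (∑ k ∈ Finset.range K, EG k) = SG at *
  generalize (∑ k ∈ Finset.range K, ED k) = SD at *
  generalize (∑ k ∈ Finset.range K, EZ k) = SZ at *
  generalize R.f R.x0 - ⨅ x, R.f x = F at *
  refine gradient_le_of_coupled (x := L ^ 2 * SX) (x' := L ^ 2 * SX') (D := L ^ 2 * SD / R.τ)
    (Y := SY) (z := L ^ 2 * SZ) (by positivity) (by positivity) hSY
    (by positivity) (by positivity) (by positivity) hy0' (by positivity) (by positivity) hp0
    (by linarith [h.p_nonneg]) hlam0 hlam1 (by positivity) hβ hκ ?_ ?_ hX1' hX2' ?_ ?_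
  · rw [div_le_iff₀ hτ]
    linarith only [hD]
  · have h1 := mul_le_mul_of_nonneg_left hsum (by positivity : 0 ≤ 2 * n / (R.η * R.τ))
    have h2 : 2 * n / (R.η * R.τ) * (R.η * R.τ / 2 * SG) = n * SG := by field_simp
    have h3 : 2 * n / (R.η * R.τ) * (F + R.η * L ^ 2 / n * (R.τ * SX + SD)
        + K * (2 * L * R.η ^ 2 * (R.τ * s / n)))
        = 2 * (n * F / (R.η * R.τ)) + 2 * (L ^ 2 * SX + L ^ 2 * SD / R.τ)
          + 4 * (L * R.η * (K * s)) := by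
      field_simp
      ring
    rwa [h2, h3] at h1
  · refine hY.trans_eq ?_
    ring
  · refine (mul_le_mul_of_nonneg_left hZ (sq_nonneg L)).trans_eq ?_
    field_simp
    ring

end Run

end

end PISCO

theorem theorem1 :
    ∃ C : ℝ, 0 < C ∧
      ∀ {Ω : Type*} [MeasurableSpace Ω] (μ : Measure Ω) [IsProbabilityMeasure μ] {S : Type*}
        (d n m b To K : ℕ) (loss : PISCO.Vec d → S → ℝ) (D : Fin n → Fin m → S)
        (graph : SimpleGraph (Fin n)) (W : Matrix (Fin n) (Fin n) ℝ)
        (p L σ α ηc ηl η lam : ℝ) (x0 : PISCO.Vec d)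
        (server : ℕ → Ω → Bool) (batch : ℕ → ℕ → Fin n → Ω → PISCO.Batch m b)
        (iter : ℕ → Ω → PISCO.State d n),
        0 < n → 0 < b → 0 < To → 0 < K →
        -- the semi-decentralized network
        PISCO.IsMixingMatrix graph W → 0 ≤ p → p ≤ 1 →
        lam = PISCO.expectedMixingRate W p → 0 < lam →
        -- the objectives
        BddBelow (Set.range (PISCO.globalLoss loss D)) →
        0 < L → (∀ i, PISCO.IsLSmooth (PISCO.localLoss loss D i) L) →
        -- the random choices and the stochastic gradients
        PISCO.IsSampling μ p server batch →
        0 ≤ σ → PISCO.IsUnbiasedBoundedVariance μ loss D σ batch →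
        -- the step sizes
        1 ≤ α → ηc = α * √(1 + p) * lam →
        0 < ηl → ηl ≤ √(1 + p) * lam / (360 * α * L * (To + 1)) → η = ηc * ηl →
        -- the iterates
        (∀ k ω, iter k ω = PISCO.iterates loss D W To ηc ηl x0 (fun j => server j ω)
          (fun j t i => batch j t i ω) k) →
        (∀ k, Integrable
          (fun ω => ‖gradient (PISCO.globalLoss loss D) (PISCO.avg (iter k ω).X)‖ ^ 2) μ) ∧
        Integrable (fun ω => PISCO.frobSq
          ((iter 0 ω).Y - PISCO.mix (iter 0 ω).Y (PISCO.avgMatrix n))) μ ∧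
        (1 / (K : ℝ)) * ∑ k ∈ Finset.range K,
            ∫ ω, ‖gradient (PISCO.globalLoss loss D) (PISCO.avg (iter k ω).X)‖ ^ 2 ∂μ
          ≤ C * ((PISCO.globalLoss loss D x0 - ⨅ x, PISCO.globalLoss loss D x) / (η * To * K)
                + (L ^ 2 * To ^ 2 * ηl ^ 2 + L * η / n) * (σ ^ 2 / b))
            + C * ((1 - p) * L ^ 2 * To ^ 2 * η ^ 2 / ((1 + p) ^ 2 * lam ^ 4) * (σ ^ 2 / b)
                + 1 / (n * K) * ∫ ω, PISCO.frobSq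
                    ((iter 0 ω).Y - PISCO.mix (iter 0 ω).Y (PISCO.avgMatrix n)) ∂μ) := by
  -- `80000 = 16 * 5000`, as `(T_o + 1)² ≤ 4 T_o²` and `(1 + p)² ≤ 4`.
  refine ⟨80000, by norm_num, ?_⟩
  intro Ω _ μ _ S d n m b To K loss D graph W p L σ α ηc ηl η lam x0 server batch iter
    hn hb hTo hK hW hp0 hp1 hlam hlam0 hbdd hL hsmooth hsamp hσ hnoise hα hηc hηl0 hηl hη hiter
  let R : PISCO.Run Ω S d n m b := ⟨loss, D, W, To, ηc, ηl, x0, server, batch⟩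
  have hR : R.Valid μ p L (σ ^ 2 / b) :=
    ⟨hn, hW.doubly_stochastic, hp0, hp1, hL, hsmooth, hsamp, hnoise.unbiased, hnoise.variance⟩
  obtain rfl : iter = fun k ω => R.state k ω := by funext k ω; exact hiter k ω
  have hY0 : (fun ω => PISCO.frobSq ((R.state 0 ω).Y
      - PISCO.mix (R.state 0 ω).Y (PISCO.avgMatrix n))) = R.trackingErr 0 := by
    funext ω; rw [PISCO.sub_mix_avgMatrix]; rfl
  refine ⟨fun k => (hR.finiteMeasurable_gradSq k).integrable, ?_, ?_⟩
  · rw [hY0]; exact (hR.finiteMeasurable_trackingErr 0).integrable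
  simp only [hY0]
  have hnR : (0 : ℝ) < n := by exact_mod_cast hn
  have hKR : (0 : ℝ) < K := by exact_mod_cast hK
  have hToR : (1 : ℝ) ≤ To := by exact_mod_cast hTo
  have hα0 : 0 < α := by linarith
  have hsq : √(1 + p) ^ 2 = 1 + p := Real.sq_sqrt (by linarith)
  have hsq1 : 1 ≤ √(1 + p) := by
    rw [Real.one_le_sqrt]; linarith
  have hlam1 : lam ≤ 1 := hlam ▸ hR.expectedMixingRate_le_one
  have hηc0 : lam ≤ ηc := by
    rw [hηc]
    exact le_mul_of_one_le_left hlam0.le (one_le_mul_of_one_le_of_one_le hα hsq1)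
  have hη0 : 0 < η := by rw [hη]; exact mul_pos (hlam0.trans_le hηc0) hηl0
  have hRη : R.η = η := hη.symm
  have hRτ : (R.τ : ℝ) = To + 1 := by simp [PISCO.Run.τ, R]
  have hκ0 : L * ηl * (To + 1) ≤ √(1 + p) * lam / (360 * α) := by
    have := mul_le_mul_of_nonneg_left hηl (by positivity : 0 ≤ L * ((To : ℝ) + 1))
    calc L * ηl * (To + 1) = L * (To + 1) * ηl := by ring
      _ ≤ _ := this
      _ = _ := by field_simp
  have hβκ : L * η * (To + 1) = ηc * (L * ηl * (To + 1)) := by rw [hη]; ring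
  have hβ : L * η * (To + 1) ≤ lam ^ 2 / 180 := by
    have := mul_le_mul_of_nonneg_left hκ0 (hlam0.le.trans hηc0)
    rw [hβκ]
    refine this.trans ?_
    calc ηc * (√(1 + p) * lam / (360 * α)) = √(1 + p) ^ 2 * lam ^ 2 / 360 := by
          rw [hηc]; field_simp
      _ ≤ _ := by rw [hsq]; nlinarith [sq_nonneg lam]
  have hκ : (L * ηl * (To + 1)) ^ 2 ≤ (L * η * (To + 1)) ^ 2 / lam ^ 2 := by
    rw [le_div_iff₀ (by positivity), hβκ, mul_pow ηc, mul_comm]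
    exact mul_le_mul_of_nonneg_right (pow_le_pow_left₀ hlam0.le hηc0 2) (sq_nonneg _)
  have hκ8 : (L * ηl * (To + 1)) ^ 2 ≤ 1 / 8 := by
    refine hκ.trans ?_
    rw [div_le_iff₀ (by positivity)]
    have h1 := pow_le_pow_left₀ (by positivity) hβ 2
    have h2 : lam ^ 2 ≤ 1 := pow_le_one₀ hlam0.le hlam1
    nlinarith [sq_nonneg lam]
  have key := hR.sum_gradSq_le (by positivity) hlam hlam0 hbdd (by rw [hRη]; exact hη0)
    (by rw [hRη, hRτ]; exact hβ) (by rw [hRη, hRτ]; exact hκ) (by rw [hRτ]; exact hκ8) K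
  rw [hRη, hRτ] at key
  set s := σ ^ 2 / (b : ℝ)
  have hs : 0 ≤ s := by positivity
  set E0 := ∫ ω, R.trackingErr 0 ω ∂μ
  have hE0 : 0 ≤ E0 := integral_nonneg fun ω => PISCO.Run.trackingErr_nonneg 0 ω
  have hF0 : 0 ≤ PISCO.globalLoss loss D x0 - ⨅ x, PISCO.globalLoss loss D x :=
    sub_nonneg.2 (ciInf_le hbdd _)
  change (1 / (K : ℝ)) * ∑ k ∈ Finset.range K, ∫ ω, R.gradSq k ω ∂μ ≤ _
  change n * ∑ k ∈ Finset.range K, ∫ ω, R.gradSq k ω ∂μ ≤ 5000 * (n *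
    (PISCO.globalLoss loss D x0 - ⨅ x, PISCO.globalLoss loss D x) / (η * (To + 1)) + _ + _ + _ + _)
    at key
  generalize ∑ k ∈ Finset.range K, ∫ ω, R.gradSq k ω ∂μ = G at *
  generalize PISCO.globalLoss loss D x0 - ⨅ x, PISCO.globalLoss loss D x = F at *
  have key2 := mul_le_mul_of_nonneg_left key (by positivity : 0 ≤ 1 / ((n : ℝ) * K))
  have hl : 1 / ((n : ℝ) * K) * (n * G) = 1 / (K : ℝ) * G := by field_simp
  have hr : 1 / ((n : ℝ) * K) * (5000 * (n * F / (η * (To + 1)) + L * η * (K * s)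
        + (L * ηl * (To + 1)) ^ 2 * (K * (n * s))
        + (L * η * (To + 1)) ^ 2 / lam ^ 4 * ((1 - p) * (K * (n * s))) + E0))
      = 5000 * (F / (η * (To + 1) * K)) + 5000 * (L * η / n * s)
        + 5000 * ((To + 1) ^ 2 * (L ^ 2 * ηl ^ 2 * s))
        + 5000 * ((To + 1) ^ 2 * ((1 - p) * L ^ 2 * η ^ 2 / lam ^ 4 * s))
        + 5000 * (1 / (n * K) * E0) := by
    field_simp
  rw [hl] at key2
  refine (key2.trans_eq hr).trans ?_
  have hT2 : ((To : ℝ) + 1) ^ 2 ≤ 4 * To ^ 2 := by nlinarith only [hToR]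
  have h1 : F / (η * (To + 1) * K) ≤ F / (η * To * K) := by
    gcongr
    linarith
  have h2 : ((To : ℝ) + 1) ^ 2 * (L ^ 2 * ηl ^ 2 * s) ≤ 4 * To ^ 2 * (L ^ 2 * ηl ^ 2 * s) :=
    mul_le_mul_of_nonneg_right hT2 (by positivity)
  have h3 : ((To : ℝ) + 1) ^ 2 * ((1 - p) * L ^ 2 * η ^ 2 / lam ^ 4 * s)
      ≤ 16 * ((1 - p) * L ^ 2 * To ^ 2 * η ^ 2 / ((1 + p) ^ 2 * lam ^ 4) * s) := by
    have hq : 0 ≤ 1 - p := by linarith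
    have hp2 : (1 + p) ^ 2 ≤ 4 := by nlinarith only [hp0, hp1]
    calc ((To : ℝ) + 1) ^ 2 * ((1 - p) * L ^ 2 * η ^ 2 / lam ^ 4 * s)
        ≤ 4 * To ^ 2 * ((1 - p) * L ^ 2 * η ^ 2 / lam ^ 4 * s) :=
          mul_le_mul_of_nonneg_right hT2 (by positivity)
      _ = (1 + p) ^ 2 * (4 * ((1 - p) * L ^ 2 * To ^ 2 * η ^ 2 / ((1 + p) ^ 2 * lam ^ 4) * s)) := by
          field_simp
      _ ≤ 4 * (4 * ((1 - p) * L ^ 2 * To ^ 2 * η ^ 2 / ((1 + p) ^ 2 * lam ^ 4) * s)) :=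
          mul_le_mul_of_nonneg_right hp2 (by positivity)
      _ = _ := by ring
  have hz1 : 0 ≤ F / (η * To * K) := by positivity
  have hz2 : 0 ≤ L * η / n * s := by positivity
  have hz3 : 0 ≤ To ^ 2 * (L ^ 2 * ηl ^ 2 * s) := by positivity
  have hz4 : 0 ≤ 1 / (n * K) * E0 := by positivity
  linarith only [h1, h2, h3, hz1, hz2, hz3, hz4]
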